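/- Let $\mathfrak C$ be a countable, left cancellative small category, viewed as its set of morphisms, with set of objects $\mathfrak C^0\subseteq\mathfrak C$ (objects are identified with identity morphisms), domain and target maps $\mathfrak d,\mathfrak t$ (so $cd$ is defined iff $\mathfrak d(c)=\mathfrak t(d)$), and set of invertible elements $\mathfrak C^*$. Assume that $\mathfrak C$ is finitely aligned: every $a\mathfrak C\cap b\mathfrak C$ is a finite union of sets $c\,\mathfrak C$. Write $a\preceq b$ if $b\in a\mathfrak C$, $a\prec b$ if $b\mathfrak C\subsetneq a\mathfrak C$, and $a=^*b$ if $a\in b\,\mathfrak C^*$. **Groupoid.** Let $I_l$ be the smallest set of partial bijections of $\mathfrak C$ that contains $\mathfrak d(c)\mathfrak C\to c\,\mathfrak C,\ x\mapsto cx$ for all $c\in\mathfrak C$ and is closed under composition and inverses, and let $\mathcal J=\{\mathrm{dom}(s): s\in I_l\}$, with intersection as product. Let $\Omega$ be the space, with the topology of pointwise convergence, of all non-zero multiplicative maps $\chi:\mathcal J\to\{0,1\}$ with $\chi(\emptyset)=0$ if $\emptyset\in\mathcal J$, such that $e=f_1\cup\dots\cup f_n$ in $\mathcal J$ and $\chi(e)=1$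 imply $\chi(f_i)=1$ for some $i$. The groupoid $I_l\ltimes\Omega$ with unit space $\Omega$ consists of the classes $[s,\chi]$ with $s\in I_l$, $\chi(\mathrm{dom}(s))=1$, where $[s,\chi]=[t,\chi]$ iff $s|_e=t|_e$ for some $e\in\mathcal J$ with $\chi(e)=1$; the source of $[s,\chi]$ is $\chi$ and its range is $s.\chi=\chi(s^{-1}(\cdot))$. A subset $X\subseteq\Omega$ is invariant if it contains the range of every arrow whose source it contains. For $x\in\mathfrak C$, $\chi_x\in\Omega$ is given by $\chi_x(e)=1$ iff $x\mathfrak C\subseteq e$. **Garside family.** For $\mathfrak S\subseteq\mathfrak C$ put $\mathfrak S^\sharp=\mathfrak S\mathfrak C^*\cup\mathfrak C^*$. A path (finite or infinite sequence of composable elements) $s_1s_2\cdots$ is normal if for all $k$ and all $r\in\mathfrak S$, $r\preceq s_ks_{k+1}$ implies $r\preceq s_k$. $\mathfrak S$ is a Garside family if (i) for $r,s\in\mathfrak S$ and $a\in\mathfrak C$ with $r,s\preceq a$ there is $t\in\mathfrak S$ with $r,s\preceq t\preceq a$; (ii) $\mathfrak S\cup\mathfrak C^*$ generates $\mathfrak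 C$; (iii) every right divisor of an element of $\mathfrak S^\sharp$ is in $\mathfrak S^\sharp$; (iv) every element of $\mathfrak C$ is the product of a finite normal path in $\mathfrak S^\sharp$. Let $\mathfrak S$ be a Garside family with $\mathfrak S\cap\mathfrak C^*=\emptyset$ which is $=^*$-transverse ($s=^*t$ implies $s=t$ for $s,t\in\mathfrak S$) and locally bounded (for no object $\mathfrak v$ is there an infinite sequence $s_1\prec s_2\prec\cdots$ in $\mathfrak S$ with all $\mathfrak t(s_i)=\mathfrak v$). For non-invertible $a$, let $H(a)$ be its head, i.e. the element of $\mathfrak S$ with $H(a)\preceq a$ such that $r\preceq H(a)$ for all $r\in\mathfrak S$ with $r\preceq a$. Let $\mathcal W$ be the set of non-empty finite or infinite normal paths (words) in $\mathfrak S$. If $w\in\mathcal W$ is finite, $\chi_w$ is the character $\chi_x$ of its product $x$, and $\mathfrak d(w)=\mathfrak d(x)$; if $w=s_1s_2\cdots$ is infinite, $\chi_w(e)=1$ iff $s_1\cdots s_n\in e$ for some $n$. **Pairs.** For a sequence $(t_i)$ in $\mathfrak S$ and $s\in\mathfrak S\cup\mathfrak C^0$ write $\lim_i t_i=s$ if $s\preceq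 t_i$ for almost all $i$, and $r\preceq s$ for every $r\in\mathfrak S\cup\mathfrak C^0$ with $r\preceq t_i$ for infinitely many $i$. Consider pairs $(\mathfrak T,\mathfrak D)$ with $\mathfrak T\subseteq\mathfrak S$ and $\mathfrak D\subseteq\mathfrak C^0$, ordered by inclusion in both components. Such a pair is - admissible if for every $t\in\mathfrak T$ there is $t'\in\mathfrak T$ with $tt'$ normal, or $\mathfrak d(t)\in\mathfrak D$; - $H$-invariant if $H(ax)\in\mathfrak T$ for all $a\in\mathfrak C\setminus\mathfrak C^*$ and $x\in\mathfrak T\cup\mathfrak D$ with $\mathfrak d(a)=\mathfrak t(x)$; - isomorphism-invariant if $u\in\mathfrak C^*$ and $\mathfrak d(u)\in\mathfrak D$ imply $\mathfrak t(u)\in\mathfrak D$ (automatic if isomorphic objects of $\mathfrak C$ are equal); - $\max^\infty_\preceq$-closed if $\lim_i t_i=s$ with all $t_i\in\mathfrak T$ and $s\in\mathfrak S\cup\mathfrak C^0$ implies $s\in\mathfrak T\cup\mathfrak D$. For $X\subseteq\Omega$, let $\mathfrak T(X)$ be the set of all letters of words $w\in\mathcal W$ with $\chi_w\in X$, and $\mathfrak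 D(X)=\{\mathfrak v\in\mathfrak C^0:\chi_{\mathfrak v}\in X\}$. For a pair $(\mathfrak T,\mathfrak D)$, let $X(\mathfrak T,\mathfrak D)$ be the set of all $\chi_w$, where $w\in\mathcal W$ has all its letters in $\mathfrak T$ and is infinite or satisfies $\mathfrak d(w)\in\mathfrak D$, together with all $\chi_{\mathfrak v}$, $\mathfrak v\in\mathfrak D$. **Theorem.** The maps $X\mapsto(\mathfrak T(X),\mathfrak D(X))$ and $(\mathfrak T,\mathfrak D)\mapsto X(\mathfrak T,\mathfrak D)$ are mutually inverse, inclusion-preserving bijections between the closed subspaces of $\Omega$ that are invariant for $I_l\ltimes\Omega$ and the admissible, $H$-invariant, isomorphism-invariant, $\max^\infty_\preceq$-closed pairs $(\mathfrak T,\mathfrak D)$ with $\mathfrak T\subseteq\mathfrak S$ and $\mathfrak D\subseteq\mathfrak C^0$. -/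

import Mathlib

open CategoryTheory Filter

universe v u

namespace GarsideCat

/-! ### Small categories as sets of morphisms -/

/-- The set of all morphisms of a category. A morphism `c` has a domain `c.dom` and a
target `c.cod`; the product `c d` means "first `d`, then `c`", and is defined if and only if
`c.dom = d.cod`. -/
structure Mor (C : Type u) [Category.{v} C] where
  dom : C
  cod : C
  hom : dom ⟶ cod

section Basic

variable {C : Type u} [Category.{v} C]

/-- The identity morphism at an object; objects are identified with identity morphisms. -/
def Mor.id (x : C) : Mor C := ⟨x, x, 𝟙 x⟩

/-- The product `a b`, defined when the domain of `a` is the target of `b`. -/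
def Mor.comp (a b : Mor C) (h : a.dom = b.cod) : Mor C :=
  ⟨b.dom, a.cod, b.hom ≫ eqToHom h.symm ≫ a.hom⟩

/-- Membership in the set of invertible morphisms. -/
def Mor.Invertible (a : Mor C) : Prop := IsIso a.hom

/-- Left divisibility: `b` lies in `a C`. -/
def LeftDvd (a b : Mor C) : Prop := ∃ (x : Mor C) (h : a.dom = x.cod), b = a.comp x h

/-- The principal right ideal `a C`. -/
def principal (a : Mor C) : Set (Mor C) := {b | LeftDvd a b}

/-- Strict left divisibility: `b C` is a proper subset of `a C`. -/
def StrictLeftDvd (a b : Mor C) : Prop := principal b ⊂ principal a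

/-- `a` is equal to `b` up to right multiplication by an invertible element. -/
def EqStar (a b : Mor C) : Prop :=
  ∃ (w : Mor C) (h : b.dom = w.cod), w.Invertible ∧ a = b.comp w h

theorem Mor.comp_assoc (a b c : Mor C) (h : a.dom = b.cod) (h' : b.dom = c.cod) :
    (a.comp b h).comp c h' = a.comp (b.comp c h') h := by
  obtain ⟨ad, ac, a⟩ := a
  obtain ⟨bd, bc, b⟩ := b
  obtain ⟨cd, cc, c⟩ := c
  dsimp only at h h'
  subst h
  subst h'
  simp only [Mor.comp, eqToHom_refl, Category.id_comp, Category.assoc]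
  congr 1
  exact congrArg (c ≫ ·) ((Category.id_comp (b ≫ a)).trans
    (congrArg (b ≫ ·) (Category.id_comp a).symm))

theorem LeftDvd.refl (x : Mor C) : LeftDvd x x :=
  ⟨Mor.id x.dom, rfl, by simp [Mor.comp, Mor.id]⟩

end Basic

/-- A category is left cancellative if `c x = c y` implies `x = y`. -/
class IsLeftCancellative (C : Type u) [Category.{v} C] : Prop where
  cancel : ∀ (c x y : Mor C) (hx : c.dom = x.cod) (hy : c.dom = y.cod),
    c.comp x hx = c.comp y hy → x = y

/-- Every intersection of two principal right ideals is a finite union of principal right ideals. -/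
def IsFinitelyAligned (C : Type u) [Category.{v} C] : Prop :=
  ∀ a b : Mor C, ∃ F : Set (Mor C), F.Finite ∧ principal a ∩ principal b = ⋃ c ∈ F, principal c

/-! ### The left inverse hull and its idempotents -/

section Hull

variable {C : Type u} [Category.{v} C] [IsLeftCancellative C]

open Classical in
/-- The partial bijection `x ↦ c x` with domain the set of morphisms with target `c.dom`
and image `c C`. -/
noncomputable def leftMul (c : Mor C) : Mor C ≃. Mor C where
  toFun x := if h : c.dom = x.cod then some (c.comp x h) else none
  invFun y := if h : LeftDvd c y then some h.choose else none
  inv x y := by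
    constructor
    · intro hx
      by_cases h : LeftDvd c y
      · rw [dif_pos h] at hx
        obtain ⟨h1, h2⟩ := h.choose_spec
        have hxe : h.choose = x := by simpa using hx
        subst hxe
        rw [dif_pos h1]
        simp [← h2]
      · simp [h] at hx
    · intro hy
      by_cases h : c.dom = x.cod
      · rw [dif_pos h] at hy
        have hye : c.comp x h = y := by simpa using hy
        have hd : LeftDvd c y := ⟨x, h, hye.symm⟩
        rw [dif_pos hd]
        obtain ⟨h1, h2⟩ := hd.choose_spec
        have := IsLeftCancellative.cancel c _ _ h1 h (h2.symm.trans hye.symm)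
        simp [this]
      · simp [h] at hy

/-- The left inverse hull: the smallest set of partial bijections that contains all `leftMul c`
and is closed under inverses and composition. `s.trans t` is "first `s`, then `t`". -/
inductive InHull : (Mor C ≃. Mor C) → Prop
  | of (c : Mor C) : InHull (leftMul c)
  | inv (s : Mor C ≃. Mor C) : InHull s → InHull s.symm
  | mul (s t : Mor C ≃. Mor C) : InHull s → InHull t → InHull (s.trans t)

/-- The domain of a partial bijection. -/
def domain (s : Mor C ≃. Mor C) : Set (Mor C) := {x | ∃ y, y ∈ s x}

variable (C) in
/-- The left inverse hull as a type. -/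
abbrev Hull : Type (max u v) := {s : Mor C ≃. Mor C // InHull s}

variable (C) in
/-- The semilattice of idempotents of the left inverse hull, realised as the set of domains of
elements of the left inverse hull (constructible right ideals). -/
abbrev Ideals : Type (max u v) := {e : Set (Mor C) // ∃ s : Mor C ≃. Mor C, InHull s ∧ e = domain s}

/-- The domain of an element of the left inverse hull, i.e. the idempotent `s⁻¹ s`. -/
def Hull.dom (s : Hull C) : Ideals C := ⟨domain s.1, s.1, s.2, rfl⟩

/-- The idempotent `s⁻¹ e s`, i.e. the preimage of `e` under `s`. -/
def Hull.preimage (s : Hull C) (e : Ideals C) : Ideals C :=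
  ⟨{x | ∃ y, y ∈ s.1 x ∧ y ∈ e.1}, by
    obtain ⟨t, ht, he⟩ := e.2
    refine ⟨s.1.trans t, InHull.mul _ _ s.2 ht, ?_⟩
    ext x
    simp only [domain, he, Set.mem_ofPred_eq, PEquiv.mem_trans]
    constructor
    · rintro ⟨y, hy, z, hz⟩
      exact ⟨z, y, hy, hz⟩
    · rintro ⟨z, y, hy, hz⟩
      exact ⟨y, hy, z, hz⟩⟩

/-- Multiplication of idempotents, i.e. intersection of subsets. -/
def Ideals.inter (e f : Ideals C) : Ideals C :=
  ⟨e.1 ∩ f.1, by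
    obtain ⟨s, hs, he⟩ := e.2
    obtain ⟨t, ht, hf⟩ := f.2
    refine ⟨(s.trans s.symm).trans t, InHull.mul _ _ (InHull.mul _ _ hs (InHull.inv _ hs)) ht, ?_⟩
    ext x
    simp only [domain, he, hf, Set.mem_inter_iff, Set.mem_ofPred_eq, PEquiv.mem_trans]
    constructor
    · rintro ⟨⟨y, hy⟩, z, hz⟩
      exact ⟨z, x, ⟨y, hy, (PEquiv.mem_iff_mem s).2 hy⟩, hz⟩
    · rintro ⟨z, x', ⟨y, hy, hy'⟩, hz⟩
      have : x' = x := by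
        have h1 : x ∈ s.symm y := (PEquiv.mem_iff_mem s).2 hy
        exact Option.mem_unique hy' h1
      subst this
      exact ⟨⟨y, hy⟩, z, hz⟩⟩

open Classical in
theorem leftMul_mem {c x y : Mor C} : y ∈ leftMul c x ↔ ∃ h : c.dom = x.cod, y = c.comp x h := by
  change y ∈ (if h : c.dom = x.cod then some (c.comp x h) else none) ↔ _
  by_cases h : c.dom = x.cod
  · simp [h, eq_comm]
  · simp [h]

theorem hull_equivariant {s : Mor C ≃. Mor C} (hs : InHull s) :
    ∀ x y z : Mor C, ∀ h : x.dom = z.cod, y ∈ s x →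
      ∃ h' : y.dom = z.cod, y.comp z h' ∈ s (x.comp z h) := by
  induction hs with
  | of c =>
    intro x y z h hy
    obtain ⟨h1, rfl⟩ := leftMul_mem.1 hy
    exact ⟨h, leftMul_mem.2 ⟨h1, Mor.comp_assoc _ _ _ _ _⟩⟩
  | inv s hs ih =>
    intro x y z h hy
    have hx : x ∈ s y := (PEquiv.mem_iff_mem s).1 hy
    have hdom : y.dom = z.cod := by
      obtain ⟨h1, -⟩ := ih y x (Mor.id y.dom) rfl hx
      exact h1.symm.trans h
    obtain ⟨h2, h3⟩ := ih y x z hdom hx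
    exact ⟨hdom, (PEquiv.mem_iff_mem s).2 h3⟩
  | mul s t hs ht ihs iht =>
    intro x y z h hy
    obtain ⟨w, hw, hy⟩ := (PEquiv.mem_trans _ _ _ _).1 hy
    obtain ⟨h1, h2⟩ := ihs x w z h hw
    obtain ⟨h3, h4⟩ := iht w y z h1 hy
    exact ⟨h3, (PEquiv.mem_trans _ _ _ _).2 ⟨_, h2, h4⟩⟩

theorem Ideals.mul_mem (e : Ideals C) {x y : Mor C} (hx : x ∈ e.1) (h : LeftDvd x y) :
    y ∈ e.1 := by
  obtain ⟨s, hs, he⟩ := e.2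
  rw [he] at hx ⊢
  obtain ⟨w, hw⟩ := hx
  obtain ⟨z, hz, rfl⟩ := h
  obtain ⟨h', hm⟩ := hull_equivariant hs x w z hz hw
  exact ⟨_, hm⟩

theorem Ideals.exists_mem (x : Mor C) : ∃ e : Ideals C, x ∈ e.1 :=
  ⟨⟨domain (leftMul (Mor.id x.cod)), _, InHull.of _, rfl⟩, _, leftMul_mem.2 ⟨rfl, rfl⟩⟩

end Hull

/-! ### The character space and the transformation groupoid -/

section Characters

variable (C : Type u) [Category.{v} C] [IsLeftCancellative C]

/-- Characters of the semilattice of constructible right ideals that are compatible with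
finite unions of subsets. -/
structure IsOmegaChar (χ : Ideals C → Bool) : Prop where
  nonzero : ∃ e, χ e = true
  mul : ∀ e f, χ (e.inter f) = (χ e && χ f)
  zero : ∀ e : Ideals C, e.1 = ∅ → χ e = false
  union : ∀ (e : Ideals C) (F : Set (Ideals C)), F.Finite → e.1 = ⋃ f ∈ F, f.1 →
    χ e = true → ∃ f ∈ F, χ f = true

/-- The space `Ω`, with the topology of pointwise convergence. -/
abbrev Omega : Type (max u v) := {χ : Ideals C → Bool // IsOmegaChar C χ}

variable {C}

open Classical in
/-- The element of `Ω` given by a sequence `a 0, a 1, …` in which each entry left divides the next: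
it takes the value one at `e` if and only if some `a n` lies in `e`. -/
noncomputable def chiSeq (a : ℕ → Mor C) (ha : ∀ n, LeftDvd (a n) (a (n + 1))) : Omega C :=
  ⟨fun e => decide (∃ n, a n ∈ e.1), by
    have mono : ∀ (e : Ideals C) (n m : ℕ), n ≤ m → a n ∈ e.1 → a m ∈ e.1 := by
      intro e n m hnm hn
      induction hnm with
      | refl => exact hn
      | step _ ih => exact e.mul_mem ih (ha _)
    refine ⟨?_, ?_, ?_, ?_⟩
    · obtain ⟨e, he⟩ := Ideals.exists_mem (a 0)
      exact ⟨e, by simpa using ⟨0, he⟩⟩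
    · intro e f
      rw [Bool.eq_iff_iff]
      simp only [decide_eq_true_eq, Bool.and_eq_true]
      constructor
      · rintro ⟨n, h1, h2⟩
        exact ⟨⟨n, h1⟩, ⟨n, h2⟩⟩
      · rintro ⟨⟨n, h1⟩, ⟨m, h2⟩⟩
        exact ⟨max n m, mono e _ _ (le_max_left _ _) h1, mono f _ _ (le_max_right _ _) h2⟩
    · intro e he
      simp [he]
    · intro e F _ he h
      simp only [decide_eq_true_eq] at h ⊢
      obtain ⟨n, hn⟩ := h
      rw [he] at hn
      simp only [Set.mem_iUnion] at hn
      obtain ⟨f, hf, hn⟩ := hn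
      exact ⟨f, hf, n, hn⟩⟩

/-- The character `χ_x` of an element `x`: it takes the value one at `e` if and only if `x ∈ e`
(equivalently, since `e` is a right ideal, `x C ⊆ e`). -/
noncomputable def chi (x : Mor C) : Omega C := chiSeq (fun _ => x) fun _ => LeftDvd.refl x

/-- The action `s.χ = χ(s⁻¹ · s)` of an element `s` of the left inverse hull on a character `χ` with
`χ(s⁻¹ s) = 1`. -/
def act (s : Hull C) (χ : Omega C) (h : χ.1 s.dom = true) : Omega C :=
  ⟨fun e => χ.1 (s.preimage e), by
    refine ⟨?_, ?_, ?_, ?_⟩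
    · refine ⟨⟨domain s.1.symm, _, InHull.inv _ s.2, rfl⟩, ?_⟩
      rw [← h]
      refine congrArg χ.1 (Subtype.ext ?_)
      ext x
      constructor
      · rintro ⟨y, hy, -⟩
        exact ⟨y, hy⟩
      · rintro ⟨y, hy⟩
        exact ⟨y, hy, x, (PEquiv.mem_iff_mem s.1).2 hy⟩
    · intro e f
      rw [← χ.2.mul]
      refine congrArg χ.1 (Subtype.ext ?_)
      ext x
      constructor
      · rintro ⟨y, hy, h1, h2⟩
        exact ⟨⟨y, hy, h1⟩, ⟨y, hy, h2⟩⟩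
      · rintro ⟨⟨y, hy, h1⟩, ⟨z, hz, h2⟩⟩
        obtain rfl := Option.mem_unique hy hz
        exact ⟨y, hy, h1, h2⟩
    · intro e he
      apply χ.2.zero
      ext x
      simp [Hull.preimage, he]
    · intro e F hF he h1
      obtain ⟨f, ⟨g, hg, rfl⟩, hf⟩ := χ.2.union (s.preimage e) (s.preimage '' F) (hF.image _) (by
        ext x
        simp only [Hull.preimage, he, Set.mem_iUnion, Set.mem_ofPred_eq, Set.mem_image,
          exists_prop]
        constructor
        · rintro ⟨y, hy, f, hf, hyf⟩
          exact ⟨s.preimage f, ⟨f, hf, rfl⟩, y, hy, hyf⟩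
        · rintro ⟨_, ⟨f, hf, rfl⟩, y, hy, hyf⟩
          exact ⟨y, hy, f, hf, hyf⟩) h1
      exact ⟨g, hg, hf⟩⟩

variable (C)

/-- Pairs `(s, χ)` with `χ(s⁻¹ s) = 1`. -/
abbrev PreGerm : Type (max u v) := {p : Hull C × Omega C // p.2.1 p.1.dom = true}

/-- `(s, χ) ∼ (t, ψ)` if `χ = ψ` and `s e = t e` for some idempotent `e` with `χ(e) = 1`. -/
def germSetoid : Setoid (PreGerm C) where
  r p q := p.1.2 = q.1.2 ∧
    ∃ e : Ideals C, p.1.2.1 e = true ∧ ∀ x ∈ e.1, p.1.1.1 x = q.1.1.1 x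
  iseqv := by
    refine ⟨?_, ?_, ?_⟩
    · intro p
      exact ⟨rfl, p.1.1.dom, p.2, fun _ _ => rfl⟩
    · rintro p q ⟨h, e, he, hx⟩
      exact ⟨h.symm, e, h ▸ he, fun x hxe => (hx x hxe).symm⟩
    · rintro p q r ⟨h, e, he, hx⟩ ⟨h', e', he', hx'⟩
      refine ⟨h.trans h', e.inter e', ?_, ?_⟩
      · rw [p.1.2.2.mul, he, h, he']
        rfl
      · rintro x ⟨h1, h2⟩
        exact (hx x h1).trans (hx' x h2)

/-- The set of arrows of the transformation groupoid of the left inverse hull acting on `Ω`.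
Its unit space is `Ω`. -/
def TransGroupoid : Type (max u v) := Quotient (germSetoid C)

variable {C}

/-- The source of `[s, χ]` is `χ`. -/
def TransGroupoid.source : TransGroupoid C → Omega C :=
  Quotient.lift (s := germSetoid C) (fun p => p.1.2) fun _ _ h => h.1

/-- The range of `[s, χ]` is `s.χ`. -/
def TransGroupoid.range : TransGroupoid C → Omega C :=
  Quotient.lift (s := germSetoid C) (fun p => act p.1.1 p.1.2 p.2) (by
    rintro ⟨⟨s, χ⟩, hs⟩ ⟨⟨t, ψ⟩, ht⟩ ⟨h, e, he, hx⟩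
    dsimp only at h he hx hs ht ⊢
    subst h
    apply Subtype.ext
    funext f
    change χ.1 (s.preimage f) = χ.1 (t.preimage f)
    have h1 : χ.1 ((s.preimage f).inter e) = χ.1 (s.preimage f) := by rw [χ.2.mul, he, Bool.and_true]
    have h2 : χ.1 ((t.preimage f).inter e) = χ.1 (t.preimage f) := by rw [χ.2.mul, he, Bool.and_true]
    rw [← h1, ← h2]
    refine congrArg χ.1 (Subtype.ext ?_)
    ext x
    constructor
    · rintro ⟨⟨y, hy, hyf⟩, hxe⟩
      exact ⟨⟨y, hx x hxe ▸ hy, hyf⟩, hxe⟩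
    · rintro ⟨⟨y, hy, hyf⟩, hxe⟩
      exact ⟨⟨y, (hx x hxe).symm ▸ hy, hyf⟩, hxe⟩)

/-- A subset of the unit space is invariant if it contains the range of every arrow whose source
it contains. -/
def IsInvariant (X : Set (Omega C)) : Prop :=
  ∀ γ : TransGroupoid C, γ.source ∈ X → γ.range ∈ X

end Characters

/-! ### Garside families -/

section Garside

variable {C : Type u} [Category.{v} C]

/-- `IsPathProd [s₁, …, sₗ] a`: the sequence `s₁, …, sₗ` (with `l ≥ 1`) is a path, i.e. the domain of
each entry is the target of the next, and its product is `a`. -/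
inductive IsPathProd : List (Mor C) → Mor C → Prop
  | single (a : Mor C) : IsPathProd [a] a
  | cons (a : Mor C) (l : List (Mor C)) (b : Mor C) (h : a.dom = b.cod) :
      IsPathProd l b → IsPathProd (a :: l) (a.comp b h)

/-- All elements of `S` times an invertible, and all invertibles. -/
def sharp (S : Set (Mor C)) : Set (Mor C) := {a | (∃ s ∈ S, EqStar a s) ∨ a.Invertible}

/-- `s t` is a path of length two such that every left divisor in `S` of the product `s t`
left divides `s`. -/
def NormalPair (S : Set (Mor C)) (s t : Mor C) : Prop :=
  ∃ h : s.dom = t.cod, ∀ r ∈ S, LeftDvd r (s.comp t h) → LeftDvd r s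

/-- Garside families. -/
structure IsGarsideFamily (S : Set (Mor C)) : Prop where
  right_comultiples : ∀ r ∈ S, ∀ s ∈ S, ∀ a : Mor C, LeftDvd r a → LeftDvd s a →
    ∃ t ∈ S, LeftDvd r t ∧ LeftDvd s t ∧ LeftDvd t a
  generates : ∀ a : Mor C, ∃ l, IsPathProd l a ∧ ∀ s ∈ l, s ∈ S ∨ s.Invertible
  right_divisors : ∀ (a b : Mor C) (h : a.dom = b.cod), a.comp b h ∈ sharp S → b ∈ sharp S
  normal_decomposition : ∀ a : Mor C, ∃ l, IsPathProd l a ∧ (∀ s ∈ l, s ∈ sharp S) ∧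
    l.IsChain (NormalPair S)

/-- `S` contains at most one element of each class of `EqStar`. -/
def IsTransverse (S : Set (Mor C)) : Prop := ∀ s ∈ S, ∀ t ∈ S, EqStar s t → s = t

/-- There is no infinite strictly increasing sequence in `S` (for left divisibility) of elements with a
common target. -/
def IsLocallyBounded (S : Set (Mor C)) : Prop :=
  ∀ x : C, ¬ ∃ s : ℕ → Mor C, (∀ i, s i ∈ S ∧ (s i).cod = x) ∧
    ∀ i, StrictLeftDvd (s i) (s (i + 1))

/-- `s` is a head of `a`: the greatest left divisor of `a` in `S`. -/
def IsHead (S : Set (Mor C)) (a s : Mor C) : Prop :=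
  s ∈ S ∧ LeftDvd s a ∧ ∀ r ∈ S, LeftDvd r a → LeftDvd r s

/-- Non-empty normal words in `S`: finite ones `s₁ ⋯ sₗ`, recorded with their product in the
category, and infinite ones `s₁ s₂ ⋯`. -/
inductive NormalWord (S : Set (Mor C)) : Type (max u v)
  | finite (l : List (Mor C)) (a : Mor C) (isProd : IsPathProd l a) (mem : ∀ s ∈ l, s ∈ S)
      (normal : l.IsChain (NormalPair S)) : NormalWord S
  | infinite (w : ℕ → Mor C) (mem : ∀ n, w n ∈ S)
      (normal : ∀ n, NormalPair S (w n) (w (n + 1))) : NormalWord S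

/-- The set of letters of a normal word. -/
def NormalWord.letters {S : Set (Mor C)} : NormalWord S → Set (Mor C)
  | finite l _ _ _ _ => {s | s ∈ l}
  | infinite w _ _ => Set.range w

/-- A normal word ends in `D` if it is infinite, or finite with the domain of its product in `D`. -/
def NormalWord.EndsIn {S : Set (Mor C)} (D : Set C) : NormalWord S → Prop
  | finite _ a _ _ _ => a.dom ∈ D
  | infinite _ _ _ => True

/-- The products of the non-empty initial segments of an infinite path. -/
def prefixProd (w : ℕ → Mor C) (h : ∀ n, (w n).dom = (w (n + 1)).cod) :
    (n : ℕ) → {a : Mor C // a.dom = (w n).dom}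
  | 0 => ⟨w 0, rfl⟩
  | n + 1 => ⟨(prefixProd w h n).1.comp (w (n + 1)) ((prefixProd w h n).2.trans (h n)), rfl⟩

/-- The character of a normal word `w`. If `w` is finite, it is the character of its product; if `w`
is infinite, it takes the value one at `e` if and only if `e` contains the product of some initial
segment. -/
noncomputable def NormalWord.chi [IsLeftCancellative C] {S : Set (Mor C)} : NormalWord S → Omega C
  | finite _ a _ _ _ => GarsideCat.chi a
  | infinite w _ normal =>
      chiSeq (fun n => (prefixProd w (fun k => (normal k).1) n).1) fun n =>
        ⟨w (n + 1), (prefixProd w (fun k => (normal k).1) n).2.trans (normal n).1, rfl⟩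

/-! ### Pairs `(T, D)` -/

/-- For every `t ∈ T` there is `t' ∈ T` such that `t t'` is normal, or the domain of `t` is in `D`. -/
def IsAdmissible (S T : Set (Mor C)) (D : Set C) : Prop :=
  ∀ t ∈ T, (∃ t' ∈ T, NormalPair S t t') ∨ t.dom ∈ D

/-- The union of `T` and `D` as a set of morphisms. -/
def unionObj (T : Set (Mor C)) (D : Set C) : Set (Mor C) := T ∪ Mor.id '' D

/-- For all non-invertible `a` and all `x ∈ T ∪ D` such that `a x` is defined, the head of `a x`
lies in `T`. -/
def IsHInvariant (S T : Set (Mor C)) (D : Set C) : Prop :=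
  ∀ a : Mor C, ¬ a.Invertible → ∀ x ∈ unionObj T D, ∀ h : a.dom = x.cod,
    ∃ s ∈ T, IsHead S (a.comp x h) s

/-- If the domain of an invertible element is in `D`, then so is its target. -/
def IsIsoInvariant (D : Set C) : Prop :=
  ∀ w : Mor C, w.Invertible → w.dom ∈ D → w.cod ∈ D

/-- `s` is the limit of the sequence `t`: `s` is an element of `S` or an object, it left divides
almost all `t i`, and it is a right multiple of every element of `S` and every object that left
divides infinitely many `t i`. In other words, for every subsequence of `t`, it is the greatest
element of `S` or object that left divides almost all members of the subsequence. -/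
def IsLimit (S : Set (Mor C)) (t : ℕ → Mor C) (s : Mor C) : Prop :=
  s ∈ unionObj S Set.univ ∧ (∀ᶠ i in atTop, LeftDvd s (t i)) ∧
    ∀ r ∈ unionObj S Set.univ, (∃ᶠ i in atTop, LeftDvd r (t i)) → LeftDvd r s

/-- Limits of sequences in `T` lie in `T ∪ D`. -/
def IsMaxClosed (S T : Set (Mor C)) (D : Set C) : Prop :=
  ∀ t : ℕ → Mor C, (∀ i, t i ∈ T) → ∀ s, IsLimit S t s → s ∈ unionObj T D

variable [IsLeftCancellative C]

/-- The set of letters of the normal words whose characters lie in `X`. -/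
def lettersOf (S : Set (Mor C)) (X : Set (Omega C)) : Set (Mor C) :=
  {t | ∃ w : NormalWord S, w.chi ∈ X ∧ t ∈ w.letters}

/-- The set of objects whose characters lie in `X`. -/
def objectsOf (X : Set (Omega C)) : Set C := {x | chi (Mor.id x) ∈ X}

/-- The characters of the normal words with letters in `T` which, if finite, end in `D`, and the
characters of the objects in `D`. -/
def subspaceOf (S T : Set (Mor C)) (D : Set C) : Set (Omega C) :=
  {χ | ∃ w : NormalWord S, w.letters ⊆ T ∧ w.EndsIn D ∧ χ = w.chi} ∪
    {χ | ∃ x ∈ D, χ = chi (Mor.id x)}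

variable (C) in
/-- The closed invariant subspaces of `Ω`, ordered by inclusion. -/
abbrev ClosedInvariant : Type (max u v) := {X : Set (Omega C) // IsClosed X ∧ IsInvariant X}

/-- The conditions on a pair `(T, D)` in the classification of closed invariant subspaces. -/
structure IsInvariantPair (S T : Set (Mor C)) (D : Set C) : Prop where
  subset : T ⊆ S
  admissible : IsAdmissible S T D
  hInvariant : IsHInvariant S T D
  isoInvariant : IsIsoInvariant D
  maxClosed : IsMaxClosed S T D

/-- The pairs `(T, D)` in the classification, ordered by inclusion in both components. -/
abbrev InvariantPair (S : Set (Mor C)) : Type (max u v) :=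
  {p : Set (Mor C) × Set C // IsInvariantPair S p.1 p.2}

end Garside

end GarsideCat

/-!
A character `χ ∈ Ω` is studied through the elements `c` that it *supports*, meaning `χ(c C) = 1`.
Constructible right ideals are finite unions of principal ones (`Ideals.isFinUnion`), so these
elements form a directed family that determines `χ`, and pointwise convergence in `Ω` can be
tested on principal right ideals (`tendsto_omega_iff`). Invariance of a subspace for the groupoid
means that it is closed under the passage from `χ` to the translate `c.χ` and back
(`isInvariant_iff`).

The Garside family enters through the head law `IsGarsideFamily.hasHeadLaw`: an element of `S`
that left divides `a b` left divides `a g` for some left divisor `g` of `b` which lies in `S` up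
to invertibles. By local boundedness, each character either is the character of an object or has a
*head*, the greatest element of `S` that it supports (`IsBoundedGarside.head_or_object`).
Splitting off heads repeatedly spells a normal word. By the head law for products, a supported
product of `n` elements of `S` left divides the product of the first `n` letters (`IsPrefix.dvd`),
so the word determines the character. This gives a coinductive description of `X(T, D)`: it is the
largest set of characters each of which is the character of an object in `D`, or has a head in `T`
whose removal leads back to the set (`isProgressive_subspaceOf`,
`IsProgressive.subset_subspaceOf`).

For a pair `(T, D)` satisfying the four conditions, both invariance and closedness of `X(T, D)`
come from this description, applied to the set of all translates of elements of `X(T, D)` and to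
the closure of `X(T, D)`. In the first case the heads lie in `T` by `H`-invariance. In the second
case the head of a limit of characters is the limit of their heads, so it lies in `T` because the
pair is closed under limits; here countability of `C` allows sequences to be used.

Conversely, the letters of an invariant subspace `X` are the heads of its elements
(`mem_lettersOf_iff`), and the conditions on the pair of `X` are statements about heads of
translates and of limits. That `X` is recovered from its pair follows in one direction from the
coinductive description. In the other, an infinite normal word in letters of `X` is approximated
by its initial segments, each prolonged by an element of `X` whose head is the next letter
(`chi_infinite_mem`).
-/

namespace GarsideCat

local infix:50 " ≼ " => LeftDvd

/-! ### Left divisibility and invertible elements -/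

section Divisibility

variable {C : Type u} [Category.{v} C]

theorem Mor.comp_id (a : Mor C) (x : C) (h : a.dom = (Mor.id x).cod) :
    a.comp (Mor.id x) h = a := by
  obtain ⟨d, c, a⟩ := a
  obtain rfl : d = x := h
  simp [Mor.comp, Mor.id]

theorem Mor.id_comp (a : Mor C) (x : C) (h : (Mor.id x).dom = a.cod) :
    (Mor.id x).comp a h = a := by
  obtain ⟨d, c, a⟩ := a
  obtain rfl : x = c := h
  refine congrArg (Mor.mk _ _) ?_
  change a ≫ 𝟙 _ ≫ 𝟙 _ = a
  simp

theorem Mor.id_injective : Function.Injective (Mor.id : C → Mor C) := fun _ _ h =>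
  congrArg Mor.dom h

theorem LeftDvd.comp (a b : Mor C) (h : a.dom = b.cod) : a ≼ a.comp b h := ⟨b, h, rfl⟩

theorem LeftDvd.cod_eq {a b : Mor C} (h : a ≼ b) : a.cod = b.cod := by
  obtain ⟨x, hx, rfl⟩ := h
  rfl

theorem LeftDvd.trans {a b c : Mor C} (hab : a ≼ b) (hbc : b ≼ c) : a ≼ c := by
  obtain ⟨x, hx, rfl⟩ := hab
  obtain ⟨y, hy, rfl⟩ := hbc
  exact ⟨x.comp y hy, hx, Mor.comp_assoc _ _ _ _ _⟩

theorem LeftDvd.comp_left {a b c : Mor C} (hab : a.dom = b.cod) (hac : a.dom = c.cod)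
    (h : b ≼ c) : a.comp b hab ≼ a.comp c hac := by
  obtain ⟨x, hx, rfl⟩ := h
  exact ⟨x, hx, (Mor.comp_assoc _ _ _ _ _).symm⟩

theorem LeftDvd.id_cod (a : Mor C) : Mor.id a.cod ≼ a := ⟨a, rfl, (Mor.id_comp _ _ _).symm⟩

theorem LeftDvd.id_of_eq {a : Mor C} {x : C} (h : x = a.cod) : Mor.id x ≼ a := h ▸ LeftDvd.id_cod a

theorem Mor.id_invertible (x : C) : (Mor.id x).Invertible := by
  unfold Mor.Invertible Mor.id
  infer_instance

theorem Mor.Invertible.exists_inverse {a : Mor C} (ha : a.Invertible) :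
    ∃ (w : Mor C) (h : a.dom = w.cod) (h' : w.dom = a.cod),
      a.comp w h = Mor.id a.cod ∧ w.comp a h' = Mor.id a.dom ∧ w.Invertible := by
  obtain ⟨d, c, a⟩ := a
  have : IsIso a := ha
  refine ⟨⟨c, d, inv a⟩, rfl, rfl, ?_, ?_, ?_⟩
  · simp [Mor.comp, Mor.id]
  · simp [Mor.comp, Mor.id]
  · unfold Mor.Invertible
    infer_instance

theorem Mor.invertible_of_inverse {a w : Mor C} (h : a.dom = w.cod) (h' : w.dom = a.cod)
    (h1 : a.comp w h = Mor.id a.cod) (h2 : w.comp a h' = Mor.id a.dom) : a.Invertible := by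
  obtain ⟨d, c, a⟩ := a
  obtain ⟨d', c', w⟩ := w
  obtain rfl : d = c' := h
  obtain rfl : d' = c := h'
  refine ⟨w, ?_, ?_⟩
  · simpa [Mor.comp, Mor.id] using h2
  · simpa [Mor.comp, Mor.id] using h1

theorem Mor.Invertible.comp {a b : Mor C} (ha : a.Invertible) (hb : b.Invertible)
    (h : a.dom = b.cod) : (a.comp b h).Invertible := by
  obtain ⟨d, c, a⟩ := a
  obtain ⟨d', c', b⟩ := b
  obtain rfl : d = c' := h
  have : IsIso a := ha
  have : IsIso b := hb
  unfold Mor.Invertible Mor.comp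
  infer_instance

theorem Mor.Invertible.dvd {a b : Mor C} (ha : a.Invertible) (h : a.cod = b.cod) : a ≼ b := by
  obtain ⟨w, h1, h2, h3, -, -⟩ := ha.exists_inverse
  refine ⟨w.comp b (h2.trans h), h1, ?_⟩
  rw [← Mor.comp_assoc _ _ _ h1]
  simp only [h3, Mor.id_comp]

theorem EqStar.dvd {a b : Mor C} (h : EqStar a b) : a ≼ b := by
  obtain ⟨w, h, hw, rfl⟩ := h
  obtain ⟨w', h1, h2, h3, -, -⟩ := hw.exists_inverse
  refine ⟨w', h1, ?_⟩
  rw [Mor.comp_assoc _ _ _ h h1]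
  simp only [h3, Mor.comp_id]

theorem EqStar.dvd' {a b : Mor C} (h : EqStar a b) : b ≼ a := by
  obtain ⟨w, h, hw, rfl⟩ := h
  exact LeftDvd.comp _ _ _

variable [IsLeftCancellative C]

theorem LeftDvd.of_comp_left {a b c : Mor C} {hab : a.dom = b.cod} {hac : a.dom = c.cod}
    (h : a.comp b hab ≼ a.comp c hac) : b ≼ c := by
  obtain ⟨x, hx, h⟩ := h
  rw [Mor.comp_assoc a b x hab hx] at h
  exact ⟨x, hx, IsLeftCancellative.cancel _ _ _ _ _ h⟩

theorem Mor.eq_id_of_comp_eq {a b : Mor C} {h : a.dom = b.cod} (h' : a.comp b h = a) :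
    b = Mor.id a.dom :=
  IsLeftCancellative.cancel a _ _ h rfl (h'.trans (Mor.comp_id _ _ _).symm)

theorem Mor.Invertible.of_dvd {a b : Mor C} (hb : b.Invertible) (h : a ≼ b) : a.Invertible := by
  obtain ⟨x, hx, rfl⟩ := h
  obtain ⟨w, h1, h2, h3, -, -⟩ := hb.exists_inverse
  have h4 : a.comp (x.comp w h1) hx = Mor.id a.cod := (Mor.comp_assoc _ _ _ _ _).symm.trans h3
  refine Mor.invertible_of_inverse (w := x.comp w h1) hx h2 h4 ?_
  refine Mor.eq_id_of_comp_eq (a := a) (b := (x.comp w h1).comp a h2) (h := hx) ?_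
  rw [← Mor.comp_assoc a (x.comp w h1) a hx h2]
  simp only [h4, Mor.id_comp]

theorem Mor.Invertible.right_of_comp {a b : Mor C} {h : a.dom = b.cod}
    (hab : (a.comp b h).Invertible) : b.Invertible := by
  have ha : a.Invertible := hab.of_dvd (LeftDvd.comp _ _ _)
  obtain ⟨w, h1, h2, -, h4, hw⟩ := ha.exists_inverse
  have : b = w.comp (a.comp b h) h2 := by
    rw [← Mor.comp_assoc w a b h2 h]
    simp only [h4, Mor.id_comp]
  rw [this]
  exact hw.comp hab _

theorem LeftDvd.antisymm {a b : Mor C} (hab : a ≼ b) (hba : b ≼ a) : EqStar a b := by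
  obtain ⟨x, hx, rfl⟩ := hab
  obtain ⟨y, hy, h⟩ := hba
  refine ⟨y, hy, ?_, h⟩
  have h1 : x.comp y hy = Mor.id a.dom := by
    refine Mor.eq_id_of_comp_eq (a := a) (b := x.comp y hy) (h := hx) ?_
    rw [← Mor.comp_assoc a x y hx hy]
    exact h.symm
  exact Mor.Invertible.right_of_comp (h1 ▸ Mor.id_invertible _)

end Divisibility

/-! ### Constructible right ideals are finite unions of principal ones -/

section FiniteUnions

variable {C : Type u} [Category.{v} C]

/-- Finite unions of principal right ideals. -/
def IsFinUnion (E : Set (Mor C)) : Prop :=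
  ∃ F : Set (Mor C), F.Finite ∧ E = ⋃ c ∈ F, principal c

theorem isFinUnion_principal (c : Mor C) : IsFinUnion (principal c) :=
  ⟨{c}, Set.finite_singleton c, by simp⟩

theorem isFinUnion_empty : IsFinUnion (∅ : Set (Mor C)) := ⟨∅, Set.finite_empty, by simp⟩

theorem IsFinUnion.biUnion {ι : Type*} {F : Set ι} (hF : F.Finite) {E : ι → Set (Mor C)}
    (h : ∀ i ∈ F, IsFinUnion (E i)) : IsFinUnion (⋃ i ∈ F, E i) := by
  choose! G hG hE using h
  refine ⟨⋃ i ∈ F, G i, hF.biUnion hG, ?_⟩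
  ext x
  simp only [Set.mem_iUnion, exists_prop]
  constructor
  · rintro ⟨i, hi, hx⟩
    rw [hE i hi] at hx
    simp only [Set.mem_iUnion, exists_prop] at hx
    obtain ⟨c, hc, hx⟩ := hx
    exact ⟨c, ⟨i, hi, hc⟩, hx⟩
  · rintro ⟨c, ⟨i, hi, hc⟩, hx⟩
    refine ⟨i, hi, ?_⟩
    rw [hE i hi]
    simp only [Set.mem_iUnion, exists_prop]
    exact ⟨c, hc, hx⟩

/-- The preimage of a set under a partial bijection. -/
def partialPreimage (s : Mor C ≃. Mor C) (E : Set (Mor C)) : Set (Mor C) :=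
  {x | ∃ y, y ∈ s x ∧ y ∈ E}

theorem IsFinUnion.partialPreimage {s : Mor C ≃. Mor C}
    (h : ∀ c, IsFinUnion (partialPreimage s (principal c))) {E : Set (Mor C)}
    (hE : IsFinUnion E) : IsFinUnion (GarsideCat.partialPreimage s E) := by
  obtain ⟨F, hF, rfl⟩ := hE
  have : GarsideCat.partialPreimage s (⋃ c ∈ F, principal c) =
      ⋃ c ∈ F, GarsideCat.partialPreimage s (principal c) := by
    ext x
    simp only [GarsideCat.partialPreimage, Set.mem_iUnion, Set.mem_ofPred_eq, exists_prop]
    constructor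
    · rintro ⟨y, hy, c, hc, hyc⟩
      exact ⟨c, hc, y, hy, hyc⟩
    · rintro ⟨c, hc, y, hy, hyc⟩
      exact ⟨y, hy, c, hc, hyc⟩
  rw [this]
  exact IsFinUnion.biUnion hF fun c _ => h c

theorem partialPreimage_trans (s t : Mor C ≃. Mor C) (E : Set (Mor C)) :
    partialPreimage (s.trans t) E = partialPreimage s (partialPreimage t E) := by
  ext x
  simp only [partialPreimage, Set.mem_ofPred_eq, PEquiv.mem_trans]
  constructor
  · rintro ⟨z, ⟨y, hy, hz⟩, hE⟩
    exact ⟨y, hy, z, hz, hE⟩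
  · rintro ⟨y, hy, z, hz, hE⟩
    exact ⟨z, ⟨y, hy, hz⟩, hE⟩

variable [IsLeftCancellative C]

theorem mem_leftMul_symm {c x y : Mor C} :
    y ∈ (leftMul c).symm x ↔ ∃ h : c.dom = y.cod, x = c.comp y h := by
  rw [PEquiv.mem_iff_mem, leftMul_mem]

theorem domain_leftMul (c : Mor C) : domain (leftMul c) = principal (Mor.id c.dom) := by
  ext x
  constructor
  · rintro ⟨y, hy⟩
    obtain ⟨h, -⟩ := leftMul_mem.1 hy
    exact LeftDvd.id_of_eq h
  · intro h
    exact ⟨_, leftMul_mem.2 ⟨h.cod_eq, rfl⟩⟩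

theorem domain_leftMul_symm (c : Mor C) : domain (leftMul c).symm = principal c := by
  ext x
  constructor
  · rintro ⟨y, hy⟩
    obtain ⟨h, rfl⟩ := mem_leftMul_symm.1 hy
    exact LeftDvd.comp _ _ _
  · rintro ⟨y, h, rfl⟩
    exact ⟨y, mem_leftMul_symm.2 ⟨h, rfl⟩⟩

/-- The domain of `s` and the preimages of principal right ideals under `s` are finite unions of
principal right ideals. The same assertions for `s⁻¹` make the induction pass to inverses; finite
alignment is used for the preimages under left multiplications. -/
theorem InHull.isFinUnion (hC : IsFinitelyAligned C) {s : Mor C ≃. Mor C} (hs : InHull s) :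
    (IsFinUnion (domain s) ∧ ∀ c, IsFinUnion (partialPreimage s (principal c))) ∧
      IsFinUnion (domain s.symm) ∧ ∀ c, IsFinUnion (partialPreimage s.symm (principal c)) := by
  have key : ∀ s t : Mor C ≃. Mor C,
      domain (s.trans t) = partialPreimage s (domain t) := by
    intro s t
    ext x
    simp only [domain, partialPreimage, Set.mem_ofPred_eq, PEquiv.mem_trans]
    exact exists_comm.trans (exists_congr fun _ => exists_and_left)
  induction hs with
  | of c =>
    refine ⟨⟨domain_leftMul c ▸ isFinUnion_principal _, fun d => ?_⟩,
      domain_leftMul_symm c ▸ isFinUnion_principal _, fun d => ?_⟩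
    · obtain ⟨F, hF, hE⟩ := hC c d
      refine ⟨{x | ∃ h : c.dom = x.cod, c.comp x h ∈ F}, ?_, ?_⟩
      · -- Left multiplication by `c` is injective, so only finitely many `x` occur.
        let f : Mor C → Mor C := fun b =>
          open Classical in if h : ∃ (x : Mor C) (h : c.dom = x.cod), c.comp x h = b
            then h.choose else b
        refine (hF.image f).subset ?_
        rintro x ⟨h, hx⟩
        have hex : ∃ (y : Mor C) (h' : c.dom = y.cod), c.comp y h' = c.comp x h := ⟨x, h, rfl⟩
        refine ⟨_, hx, ?_⟩
        simp only [f, dif_pos hex]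
        obtain ⟨h1, h2⟩ := hex.choose_spec
        exact IsLeftCancellative.cancel c _ _ h1 h h2
      · ext x
        simp only [partialPreimage, Set.mem_iUnion, Set.mem_ofPred_eq, exists_prop]
        constructor
        · rintro ⟨y, hy, hd⟩
          obtain ⟨h, rfl⟩ := leftMul_mem.1 hy
          have hm : c.comp x h ∈ principal c ∩ principal d := ⟨LeftDvd.comp _ _ _, hd⟩
          rw [hE] at hm
          simp only [Set.mem_iUnion, exists_prop] at hm
          obtain ⟨b, hb, hbx⟩ := hm
          have hcb : b ∈ principal c ∩ principal d := by
            rw [hE]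
            simp only [Set.mem_iUnion, exists_prop]
            exact ⟨b, hb, LeftDvd.refl b⟩
          obtain ⟨y, hy, rfl⟩ := hcb.1
          exact ⟨y, ⟨hy, hb⟩, LeftDvd.of_comp_left hbx⟩
        · rintro ⟨y, ⟨hy, hb⟩, hyx⟩
          have hyx' : y ≼ x := hyx
          have hm : c.comp y hy ∈ principal c ∩ principal d := by
            rw [hE]
            simp only [Set.mem_iUnion, exists_prop]
            exact ⟨_, hb, LeftDvd.refl _⟩
          have h : c.dom = x.cod := hy.trans hyx'.cod_eq
          exact ⟨c.comp x h, leftMul_mem.2 ⟨h, rfl⟩,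
            LeftDvd.trans hm.2 (LeftDvd.comp_left hy h hyx')⟩
    · by_cases h : c.dom = d.cod
      · have : partialPreimage (leftMul c).symm (principal d) = principal (c.comp d h) := by
          ext x
          constructor
          · rintro ⟨y, hy, hd⟩
            obtain ⟨h', rfl⟩ := mem_leftMul_symm.1 hy
            exact LeftDvd.comp_left h h' hd
          · rintro ⟨y, hy, rfl⟩
            rw [Mor.comp_assoc c d y h hy]
            exact ⟨d.comp y hy, mem_leftMul_symm.2 ⟨h, rfl⟩, LeftDvd.comp d y hy⟩
        rw [this]
        exact isFinUnion_principal _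
      · have : partialPreimage (leftMul c).symm (principal d) = ∅ := by
          ext x
          refine iff_of_false ?_ (Set.notMem_empty x)
          rintro ⟨y, hy, hd⟩
          obtain ⟨h', rfl⟩ := mem_leftMul_symm.1 hy
          exact h (h'.trans (LeftDvd.cod_eq hd).symm)
        rw [this]
        exact isFinUnion_empty
  | inv s hs ih => exact ⟨ih.2, ih.1⟩
  | mul s t hs ht ihs iht =>
    refine ⟨⟨?_, fun c => ?_⟩, ?_, fun c => ?_⟩
    · rw [key]
      exact IsFinUnion.partialPreimage ihs.1.2 iht.1.1
    · rw [partialPreimage_trans]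
      exact IsFinUnion.partialPreimage ihs.1.2 (iht.1.2 c)
    · rw [PEquiv.symm_trans_rev, key]
      exact IsFinUnion.partialPreimage iht.2.2 ihs.2.1
    · rw [PEquiv.symm_trans_rev, partialPreimage_trans]
      exact IsFinUnion.partialPreimage iht.2.2 (ihs.2.2 c)

theorem Ideals.isFinUnion (hC : IsFinitelyAligned C) (e : Ideals C) : IsFinUnion e.1 := by
  obtain ⟨s, hs, he⟩ := e.2
  exact he ▸ (hs.isFinUnion hC).1.1

theorem Ideals.countable [CountableCategory C] (hC : IsFinitelyAligned C) :
    Countable (Ideals C) := by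
  have hM : Countable (Mor C) := by
    let f : Mor C → (Σ d c : C, (d ⟶ c)) := fun a => ⟨a.dom, a.cod, a.hom⟩
    refine Function.Injective.countable (f := f) ?_
    rintro ⟨d, c, a⟩ ⟨d', c', b⟩ h
    cases h
    rfl
  choose F hF hE using Ideals.isFinUnion hC
  refine Function.Injective.countable (f := fun e => (hF e).toFinset) ?_
  intro e e' h
  apply Subtype.ext
  rw [hE e, hE e', (hF e).toFinset_inj.1 h]

end FiniteUnions

/-! ### Characters as directed families of elements -/

section Supports

variable {C : Type u} [Category.{v} C] [IsLeftCancellative C]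

/-- The principal right ideal `c C` as a constructible right ideal. -/
def principalIdeal (c : Mor C) : Ideals C :=
  ⟨principal c, (leftMul c).symm, InHull.inv _ (InHull.of c), (domain_leftMul_symm c).symm⟩

/-- The character `χ` takes the value one at `c C`. -/
def Supports (χ : Omega C) (c : Mor C) : Prop := χ.1 (principalIdeal c) = true

theorem apply_eq_true_of_subset (χ : Omega C) {e f : Ideals C} (h : e.1 ⊆ f.1)
    (he : χ.1 e = true) : χ.1 f = true := by
  have h1 : e.inter f = e := Subtype.ext (Set.inter_eq_left.2 h)
  have h2 := χ.2.mul e f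
  rw [h1, he, Bool.true_and] at h2
  exact h2.symm

theorem Supports.of_dvd {χ : Omega C} {c d : Mor C} (h : Supports χ c) (hdc : d ≼ c) :
    Supports χ d :=
  apply_eq_true_of_subset χ (e := principalIdeal c) (fun _ (hx : c ≼ _) => hdc.trans hx) h

theorem apply_eq_true_iff (hC : IsFinitelyAligned C) (χ : Omega C) (e : Ideals C) :
    χ.1 e = true ↔ ∃ c ∈ e.1, Supports χ c := by
  constructor
  · intro h
    obtain ⟨F, hF, hE⟩ := e.isFinUnion hC
    obtain ⟨f, ⟨c, hc, rfl⟩, hf⟩ := χ.2.union e (principalIdeal '' F) (hF.image _)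
      (by rw [Set.biUnion_image]; exact hE) h
    refine ⟨c, ?_, hf⟩
    rw [hE]
    exact Set.mem_biUnion hc (LeftDvd.refl c)
  · rintro ⟨c, hc, h⟩
    exact apply_eq_true_of_subset χ (e := principalIdeal c)
      (fun x (hx : c ≼ x) => e.mul_mem hc hx) h

/-- The elements supported by a character form a directed set: this uses that intersections of
principal right ideals are finite unions of principal ones. -/
theorem Supports.directed (hC : IsFinitelyAligned C) {χ : Omega C} {c d : Mor C}
    (hc : Supports χ c) (hd : Supports χ d) : ∃ b, c ≼ b ∧ d ≼ b ∧ Supports χ b := by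
  have h : χ.1 ((principalIdeal c).inter (principalIdeal d)) = true := by
    rw [χ.2.mul, hc, hd]
    rfl
  obtain ⟨b, hb, h⟩ := (apply_eq_true_iff hC χ _).1 h
  exact ⟨b, hb.1, hb.2, h⟩

theorem Supports.cod_eq (hC : IsFinitelyAligned C) {χ : Omega C} {c d : Mor C}
    (hc : Supports χ c) (hd : Supports χ d) : c.cod = d.cod := by
  obtain ⟨b, h1, h2, -⟩ := hc.directed hC hd
  exact h1.cod_eq.trans h2.cod_eq.symm

theorem exists_supports (hC : IsFinitelyAligned C) (χ : Omega C) : ∃ c, Supports χ c := by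
  obtain ⟨e, he⟩ := χ.2.nonzero
  obtain ⟨c, -, h⟩ := (apply_eq_true_iff hC χ e).1 he
  exact ⟨c, h⟩

theorem omega_ext (hC : IsFinitelyAligned C) {χ ψ : Omega C}
    (h : ∀ c, Supports χ c ↔ Supports ψ c) : χ = ψ := by
  apply Subtype.ext
  funext e
  rw [Bool.eq_iff_iff, apply_eq_true_iff hC, apply_eq_true_iff hC]
  simp only [h]

theorem supports_chiSeq {a : ℕ → Mor C} {ha : ∀ n, a n ≼ a (n + 1)} {c : Mor C} :
    Supports (chiSeq a ha) c ↔ ∃ n, c ≼ a n := by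
  classical
  exact decide_eq_true_iff (p := ∃ n, c ≼ a n)

theorem supports_chi {x c : Mor C} : Supports (chi x) c ↔ c ≼ x :=
  supports_chiSeq.trans ⟨fun ⟨_, h⟩ => h, fun h => ⟨0, h⟩⟩

theorem chi_eq_of_invertible (hC : IsFinitelyAligned C) {a : Mor C} (ha : a.Invertible) :
    chi a = chi (Mor.id a.cod) :=
  omega_ext hC fun _ => supports_chi.trans <| Iff.trans
    ⟨fun h => h.trans (ha.dvd (b := Mor.id a.cod) rfl), fun h => h.trans (LeftDvd.id_cod a)⟩
    supports_chi.symm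

theorem chi_id_injective {x y : C} (h : chi (Mor.id x) = chi (Mor.id y)) : x = y := by
  have h1 : Supports (chi (Mor.id y)) (Mor.id x) := h ▸ supports_chi.2 (LeftDvd.refl _)
  exact (supports_chi.1 h1).cod_eq

/-- Pointwise convergence of characters can be tested on principal right ideals. -/
theorem tendsto_omega_iff (hC : IsFinitelyAligned C) {ι : Type*} {l : Filter ι}
    {χ : ι → Omega C} {ψ : Omega C} :
    Tendsto χ l (nhds ψ) ↔ ∀ c, ∀ᶠ i in l, (Supports (χ i) c ↔ Supports ψ c) := by
  rw [tendsto_subtype_rng, tendsto_pi_nhds]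
  simp only [nhds_discrete, tendsto_pure]
  constructor
  · intro h c
    filter_upwards [h (principalIdeal c)] with i hi
    unfold Supports
    rw [hi]
  · intro h e
    obtain ⟨F, hF, hE⟩ := e.isFinUnion hC
    have key : ∀ φ : Omega C, φ.1 e = true ↔ ∃ c ∈ F, Supports φ c := by
      intro φ
      constructor
      · intro h
        obtain ⟨c, hc, h⟩ := (apply_eq_true_iff hC φ e).1 h
        rw [hE] at hc
        obtain ⟨b, hb, hbc⟩ := Set.mem_iUnion₂.1 hc
        exact ⟨b, hb, h.of_dvd hbc⟩
      · rintro ⟨c, hc, h⟩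
        refine (apply_eq_true_iff hC φ e).2 ⟨c, ?_, h⟩
        rw [hE]
        exact Set.mem_biUnion hc (LeftDvd.refl c)
    filter_upwards [(Set.Finite.eventually_all hF).2 fun c _ => h c] with i hi
    rw [Bool.eq_iff_iff, key, key]
    exact exists_congr fun c => and_congr_right (hi c)

end Supports

/-! ### Translates of characters and invariant subspaces -/

section Translates

variable {C : Type u} [Category.{v} C] [IsLeftCancellative C]

/-- `ψ` is the translate `c.χ` of the character `χ` by the element `c`, expressed through supported
elements. As a relation it describes both the action of left multiplication by `c` and that of its
inverse. -/
def IsTranslate (c : Mor C) (χ ψ : Omega C) : Prop :=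
  Supports ψ c ∧ ∀ (x : Mor C) (h : c.dom = x.cod), Supports ψ (c.comp x h) ↔ Supports χ x

theorem IsTranslate.supports_id {c : Mor C} {χ ψ : Omega C} (h : IsTranslate c χ ψ) :
    Supports χ (Mor.id c.dom) :=
  (h.2 (Mor.id c.dom) rfl).1 ((Mor.comp_id c c.dom rfl).symm ▸ h.1)

theorem IsTranslate.dom_eq (hC : IsFinitelyAligned C) {c x : Mor C} {χ ψ : Omega C}
    (h : IsTranslate c χ ψ) (hx : Supports χ x) : c.dom = x.cod :=
  h.supports_id.cod_eq hC hx

theorem IsTranslate.exists_of_supports (hC : IsFinitelyAligned C) {c b : Mor C} {χ ψ : Omega C}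
    (h : IsTranslate c χ ψ) (hb : Supports ψ b) :
    ∃ (x : Mor C) (h : c.dom = x.cod), Supports χ x ∧ b ≼ c.comp x h := by
  obtain ⟨d, h1, ⟨x, hx, rfl⟩, h2⟩ := hb.directed hC h.1
  exact ⟨x, hx, (h.2 x hx).1 h2, h1⟩

theorem IsTranslate.supports_iff (hC : IsFinitelyAligned C) {c b : Mor C} {χ ψ : Omega C}
    (h : IsTranslate c χ ψ) :
    Supports ψ b ↔ ∃ (x : Mor C) (h : c.dom = x.cod), Supports χ x ∧ b ≼ c.comp x h :=
  ⟨h.exists_of_supports hC, fun ⟨x, hx, h1, h2⟩ => ((h.2 x hx).2 h1).of_dvd h2⟩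

theorem IsTranslate.right_unique (hC : IsFinitelyAligned C) {c : Mor C} {χ ψ ψ' : Omega C}
    (h : IsTranslate c χ ψ) (h' : IsTranslate c χ ψ') : ψ = ψ' :=
  omega_ext hC fun _ => (h.supports_iff hC).trans (h'.supports_iff hC).symm

theorem IsTranslate.left_unique (hC : IsFinitelyAligned C) {c : Mor C} {χ χ' ψ : Omega C}
    (h : IsTranslate c χ ψ) (h' : IsTranslate c χ' ψ) : χ = χ' :=
  omega_ext hC fun x =>
    ⟨fun hx => (h'.2 x (h.dom_eq hC hx)).1 ((h.2 x _).2 hx),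
      fun hx => (h.2 x (h'.dom_eq hC hx)).1 ((h'.2 x _).2 hx)⟩

theorem isTranslate_act (c : Mor C) (χ : Omega C)
    (h : χ.1 (Hull.dom ⟨leftMul c, InHull.of c⟩) = true) :
    IsTranslate c χ (act ⟨leftMul c, InHull.of c⟩ χ h) := by
  constructor
  · change χ.1 _ = true
    refine apply_eq_true_of_subset χ ?_ h
    rintro x ⟨y, hy⟩
    obtain ⟨h', rfl⟩ := leftMul_mem.1 hy
    exact ⟨_, hy, LeftDvd.comp _ _ _⟩
  · intro x hx
    change χ.1 _ = true ↔ χ.1 _ = true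
    refine iff_of_eq (congrArg (χ.1 · = true) (Subtype.ext ?_))
    ext z
    constructor
    · rintro ⟨y, hy, hxy⟩
      obtain ⟨h', rfl⟩ := leftMul_mem.1 hy
      exact LeftDvd.of_comp_left hxy
    · intro hxz
      have h' : c.dom = z.cod := hx.trans (LeftDvd.cod_eq hxz)
      exact ⟨_, leftMul_mem.2 ⟨h', rfl⟩, LeftDvd.comp_left hx h' hxz⟩

theorem isTranslate_act_symm (c : Mor C) (ψ : Omega C)
    (h : ψ.1 (Hull.dom ⟨(leftMul c).symm, InHull.inv _ (InHull.of c)⟩) = true) :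
    IsTranslate c (act ⟨(leftMul c).symm, InHull.inv _ (InHull.of c)⟩ ψ h) ψ := by
  constructor
  · refine apply_eq_true_of_subset ψ ?_ h
    exact (domain_leftMul_symm c).subset
  · intro x hx
    change ψ.1 _ = true ↔ ψ.1 _ = true
    refine iff_of_eq (congrArg (ψ.1 · = true) (Subtype.ext ?_))
    ext z
    constructor
    · intro hz
      obtain ⟨y, hy, rfl⟩ := hz
      rw [Mor.comp_assoc c x y hx hy]
      exact ⟨x.comp y hy, mem_leftMul_symm.2 ⟨hx, rfl⟩, LeftDvd.comp x y hy⟩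
    · rintro ⟨y, hy, hxy⟩
      obtain ⟨h', rfl⟩ := mem_leftMul_symm.1 hy
      exact LeftDvd.comp_left hx h' hxy

theorem exists_translate {c : Mor C} {χ : Omega C} (h : Supports χ (Mor.id c.dom)) :
    ∃ ψ, IsTranslate c χ ψ :=
  ⟨_, isTranslate_act c χ (apply_eq_true_of_subset χ (domain_leftMul c).symm.subset h)⟩

theorem exists_untranslate {c : Mor C} {ψ : Omega C} (h : Supports ψ c) :
    ∃ χ, IsTranslate c χ ψ :=
  ⟨_, isTranslate_act_symm c ψ
    (apply_eq_true_of_subset ψ (domain_leftMul_symm c).symm.subset h)⟩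

theorem IsTranslate.comp {c d : Mor C} {χ ψ φ : Omega C} (hcd : c.dom = d.cod)
    (hd : IsTranslate d χ ψ) (hc : IsTranslate c ψ φ) : IsTranslate (c.comp d hcd) χ φ := by
  refine ⟨(hc.2 d hcd).2 hd.1, fun x hx => ?_⟩
  rw [Mor.comp_assoc c d x hcd hx]
  exact (hc.2 (d.comp x hx) hcd).trans (hd.2 x hx)

theorem IsTranslate.of_comp {c d : Mor C} {χ ψ φ : Omega C} {hcd : c.dom = d.cod}
    (h : IsTranslate (c.comp d hcd) χ φ) (hc : IsTranslate c ψ φ) : IsTranslate d χ ψ := by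
  refine ⟨(hc.2 d hcd).1 h.1, fun x hx => ?_⟩
  rw [← h.2 x hx, Mor.comp_assoc c d x hcd hx]
  exact (hc.2 (d.comp x hx) hcd).symm

theorem isTranslate_id {χ : Omega C} {x : C} (h : Supports χ (Mor.id x)) :
    IsTranslate (Mor.id x) χ χ :=
  ⟨h, fun y hy => by rw [Mor.id_comp]⟩

theorem isTranslate_chi (a b : Mor C) (h : a.dom = b.cod) :
    IsTranslate a (chi b) (chi (a.comp b h)) :=
  ⟨supports_chi.2 (LeftDvd.comp _ _ _), fun x hx => by
    rw [supports_chi, supports_chi]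
    exact ⟨LeftDvd.of_comp_left, LeftDvd.comp_left _ _⟩⟩

theorem isTranslate_chi_id (a : Mor C) : IsTranslate a (chi (Mor.id a.dom)) (chi a) := by
  have := isTranslate_chi a (Mor.id a.dom) rfl
  rwa [Mor.comp_id a a.dom rfl] at this

/-- Closedness under translation by single elements extends to the whole left inverse hull.
Stating it as an equivalence lets the induction pass to inverses. -/
theorem act_mem_iff {X : Set (Omega C)}
    (h : ∀ c χ ψ, IsTranslate c χ ψ → (χ ∈ X ↔ ψ ∈ X)) {s : Mor C ≃. Mor C} (hs : InHull s) :
    ∀ (χ : Omega C) (hχ : χ.1 (Hull.dom ⟨s, hs⟩) = true), χ ∈ X ↔ act ⟨s, hs⟩ χ hχ ∈ X := by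
  induction hs with
  | of c => exact fun χ hχ => h c _ _ (isTranslate_act c χ hχ)
  | inv s hs ih =>
    intro χ hχ
    have h1 : (act ⟨s.symm, InHull.inv s hs⟩ χ hχ).1 (Hull.dom ⟨s, hs⟩) = true := by
      refine apply_eq_true_of_subset χ ?_ hχ
      rintro x ⟨y, hy⟩
      exact ⟨y, hy, x, (PEquiv.mem_iff_mem s).1 hy⟩
    rw [ih _ h1]
    refine iff_of_eq (congrArg (· ∈ X) (Subtype.ext (funext fun e => ?_)))
    -- The restriction of `e` to the range of `s` has the same value under `χ` as `e`.
    rw [Bool.eq_iff_iff]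
    constructor
    · intro he
      have h2 := χ.2.mul e (Hull.dom ⟨s.symm, InHull.inv s hs⟩)
      rw [he, hχ] at h2
      refine apply_eq_true_of_subset χ ?_ h2
      rintro x ⟨hx, y, hy⟩
      exact ⟨y, hy, x, (PEquiv.mem_iff_mem s).1 hy, hx⟩
    · refine apply_eq_true_of_subset χ ?_
      rintro x ⟨y, hy, z, hz, hze⟩
      have hx : x ∈ s y := (PEquiv.mem_iff_mem s).1 hy
      rwa [Option.mem_unique hx hz]
  | mul s t hs ht ihs iht =>
    intro χ hχ
    have h1 : χ.1 (Hull.dom ⟨s, hs⟩) = true := by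
      refine apply_eq_true_of_subset χ ?_ hχ
      rintro x ⟨y, hy⟩
      obtain ⟨z, hz, -⟩ := (PEquiv.mem_trans _ _ _ _).1 hy
      exact ⟨z, hz⟩
    have h2 : (act ⟨s, hs⟩ χ h1).1 (Hull.dom ⟨t, ht⟩) = true := by
      refine apply_eq_true_of_subset χ ?_ hχ
      rintro x ⟨y, hy⟩
      obtain ⟨z, hz, hy⟩ := (PEquiv.mem_trans _ _ _ _).1 hy
      exact ⟨z, hz, y, hy⟩
    rw [ihs χ h1, iht _ h2]
    refine iff_of_eq (congrArg (· ∈ X) (Subtype.ext (funext fun e => ?_)))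
    refine congrArg χ.1 (Subtype.ext ?_)
    exact (partialPreimage_trans s t e.1).symm

/-- A subspace is invariant if and only if it is closed under translation by elements and under the
inverse operation. -/
theorem isInvariant_iff (hC : IsFinitelyAligned C) {X : Set (Omega C)} :
    IsInvariant X ↔ ∀ c χ ψ, IsTranslate c χ ψ → (χ ∈ X ↔ ψ ∈ X) := by
  constructor
  · intro hX c χ ψ h
    constructor
    · intro hχ
      have hd : χ.1 (Hull.dom ⟨leftMul c, InHull.of c⟩) = true :=
        apply_eq_true_of_subset χ (domain_leftMul c).symm.subset h.supports_id
      rw [h.right_unique hC (isTranslate_act c χ hd)]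
      exact hX (Quotient.mk (germSetoid C) ⟨(⟨leftMul c, InHull.of c⟩, χ), hd⟩) hχ
    · intro hψ
      have hd : ψ.1 (Hull.dom ⟨(leftMul c).symm, InHull.inv _ (InHull.of c)⟩) = true :=
        apply_eq_true_of_subset ψ (domain_leftMul_symm c).symm.subset h.1
      rw [h.left_unique hC (isTranslate_act_symm c ψ hd)]
      exact hX (Quotient.mk (germSetoid C)
        ⟨(⟨(leftMul c).symm, InHull.inv _ (InHull.of c)⟩, ψ), hd⟩) hψ
  · intro h γ
    induction γ using Quotient.ind with
    | _ p => exact (act_mem_iff h p.1.1.2 p.1.2 p.2).1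

end Translates

/-! ### The head law for Garside families -/

section HeadLaw

variable {C : Type u} [Category.{v} C] {S : Set (Mor C)}

theorem mem_sharp {s : Mor C} (hs : s ∈ S) : s ∈ sharp S :=
  Or.inl ⟨s, hs, Mor.id s.dom, rfl, Mor.id_invertible _, (Mor.comp_id _ _ _).symm⟩

theorem invertible_mem_sharp {a : Mor C} (ha : a.Invertible) : a ∈ sharp S := Or.inr ha

theorem IsGarsideFamily.invertible_comp_mem_sharp (hS : IsGarsideFamily S) {a b : Mor C}
    (ha : a.Invertible) (h : a.dom = b.cod) (hb : b ∈ sharp S) : a.comp b h ∈ sharp S := by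
  obtain ⟨w, h1, h2, -, h4, -⟩ := ha.exists_inverse
  refine hS.right_divisors w (a.comp b h) h2 ?_
  rw [← Mor.comp_assoc w a b h2 h]
  simp only [h4, Mor.id_comp]
  exact hb

theorem IsGarsideFamily.exists_dvd [IsLeftCancellative C] (hS : IsGarsideFamily S)
    (hinv : ∀ s ∈ S, ¬ s.Invertible) {a : Mor C} (ha : ¬ a.Invertible) : ∃ s ∈ S, s ≼ a := by
  obtain ⟨l, hl, hmem⟩ := hS.generates a
  induction hl with
  | single a =>
    exact ⟨a, (hmem a (List.mem_singleton_self a)).resolve_right ha, LeftDvd.refl a⟩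
  | cons a l b h hl ih =>
    rcases hmem a List.mem_cons_self with haS | hai
    · exact ⟨a, haS, LeftDvd.comp _ _ _⟩
    · obtain ⟨r, hr, hrb⟩ := ih (fun hb => ha (hai.comp hb h))
        fun s hs => hmem s (List.mem_cons_of_mem a hs)
      have h1 : a.dom = r.cod := h.trans hrb.cod_eq.symm
      rcases hS.invertible_comp_mem_sharp hai h1 (mem_sharp hr) with ⟨s, hs, hsr⟩ | hi
      · exact ⟨s, hs, hsr.dvd'.trans (LeftDvd.comp_left h1 h hrb)⟩
      · exact absurd hi.right_of_comp (hinv r hr)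

/-- The conclusion of the head law for left multiplication by `a`: every element of `S` (up to
invertibles) that left divides `a b` already left divides `a g` for a left divisor `g` of `b` that
lies in `S` up to invertibles. -/
def HasHeadLaw (S : Set (Mor C)) (a : Mor C) : Prop :=
  ∀ s ∈ sharp S, ∀ (b : Mor C) (h : a.dom = b.cod), s ≼ a.comp b h →
    ∃ g ∈ sharp S, ∃ h' : a.dom = g.cod, g ≼ b ∧ s ≼ a.comp g h'

theorem hasHeadLaw_of_forall_mem {a : Mor C}
    (H : ∀ s ∈ S, ∀ (b : Mor C) (h : a.dom = b.cod), s ≼ a.comp b h →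
      ∃ g ∈ sharp S, ∃ h' : a.dom = g.cod, g ≼ b ∧ s ≼ a.comp g h') : HasHeadLaw S a := by
  rintro s (⟨t, ht, hst⟩ | hs) b h hsb
  · obtain ⟨g, hg, h', hgb, htg⟩ := H t ht b h (hst.dvd'.trans hsb)
    exact ⟨g, hg, h', hgb, hst.dvd.trans htg⟩
  · exact ⟨Mor.id b.cod, invertible_mem_sharp (Mor.id_invertible _), h, LeftDvd.id_cod b,
      hs.dvd hsb.cod_eq⟩

/-- A common multiple in `S` of `s` and `a ∈ S` below `a b` has the form `a g`, and `g` lies in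
`S` up to invertibles because `S` is closed under right divisors; general elements are products of
elements of `S` and invertibles. -/
theorem IsGarsideFamily.hasHeadLaw [IsLeftCancellative C] (hS : IsGarsideFamily S) (a : Mor C) :
    HasHeadLaw S a := by
  obtain ⟨l, hl, hmem⟩ := hS.generates a
  have base : ∀ a : Mor C, a ∈ S ∨ a.Invertible → HasHeadLaw S a := by
    rintro a (ha | ha)
    · refine hasHeadLaw_of_forall_mem fun s hs b h hsb => ?_
      obtain ⟨t, ht, hst, ⟨g, hg, rfl⟩, htb⟩ :=
        hS.right_comultiples s hs a ha _ hsb (LeftDvd.comp _ _ _)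
      exact ⟨g, hS.right_divisors a g hg (mem_sharp ht), hg, LeftDvd.of_comp_left htb, hst⟩
    · intro s hs b h hsb
      obtain ⟨w, h1, h2, h3, h4, hw⟩ := ha.exists_inverse
      have hws : w.dom = s.cod := h2.trans hsb.cod_eq.symm
      refine ⟨w.comp s hws, hS.invertible_comp_mem_sharp hw hws hs, h1, ?_, ?_⟩
      · have h5 : w.comp (a.comp b h) h2 = b := by
          rw [← Mor.comp_assoc w a b h2 h]
          simp only [h4, Mor.id_comp]
        rw [← h5]
        exact LeftDvd.comp_left (c := a.comp b h) hws h2 hsb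
      · rw [← Mor.comp_assoc a w s h1 hws]
        simp only [h3, Mor.id_comp]
        exact LeftDvd.refl s
  induction hl with
  | single a => exact base a (hmem a (List.mem_singleton_self a))
  | cons a l b h hl ih =>
    have ha := base a (hmem a List.mem_cons_self)
    have hb := ih fun s hs => hmem s (List.mem_cons_of_mem a hs)
    intro s hs c hc hsc
    rw [Mor.comp_assoc a b c h hc] at hsc
    obtain ⟨g, hg, hag, hgc, hsg⟩ := ha s hs (b.comp c hc) h hsc
    obtain ⟨g', hg', hbg, hgc', hgg⟩ := hb g hg c hc hgc
    refine ⟨g', hg', hbg, hgc', ?_⟩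
    rw [Mor.comp_assoc a b g' h hbg]
    exact hsg.trans (LeftDvd.comp_left (c := b.comp g' hbg) hag h hgg)

/-- `IsProdSharp S n c`: the element `c` is the product of `n` elements of `S` up to invertibles. For
`n = 0` this means that `c` is invertible; invertible factors are allowed, so the property is monotone
in `n`. -/
inductive IsProdSharp (S : Set (Mor C)) : ℕ → Mor C → Prop
  | zero (c : Mor C) : c.Invertible → IsProdSharp S 0 c
  | succ (n : ℕ) (r c : Mor C) (h : r.dom = c.cod) : r ∈ sharp S → IsProdSharp S n c →
      IsProdSharp S (n + 1) (r.comp c h)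

theorem IsProdSharp.mono {n m : ℕ} {c : Mor C} (h : IsProdSharp S n c) (hnm : n ≤ m) :
    IsProdSharp S m c := by
  induction hnm with
  | refl => exact h
  | step _ ih =>
    have := IsProdSharp.succ _ (Mor.id c.cod) c rfl
      (invertible_mem_sharp (Mor.id_invertible _)) ih
    rwa [Mor.id_comp c c.cod rfl] at this

theorem IsGarsideFamily.exists_isProdSharp (hS : IsGarsideFamily S) (c : Mor C) :
    ∃ n, IsProdSharp S n c := by
  obtain ⟨l, hl, hmem⟩ := hS.generates c
  have h : ∀ s ∈ l, s ∈ sharp S := fun s hs =>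
    (hmem s hs).elim (fun h => mem_sharp h) fun h => invertible_mem_sharp h
  clear hmem
  induction hl with
  | single a =>
    refine ⟨1, ?_⟩
    have := IsProdSharp.succ 0 a (Mor.id a.dom) rfl (h a (List.mem_singleton_self a))
      (IsProdSharp.zero _ (Mor.id_invertible _))
    rwa [Mor.comp_id a a.dom rfl] at this
  | cons a l b hab hl ih =>
    obtain ⟨n, hn⟩ := ih fun s hs => h s (List.mem_cons_of_mem a hs)
    exact ⟨n + 1, IsProdSharp.succ n a b hab (h a List.mem_cons_self) hn⟩

/-- The head law for products of `n` elements of `S`. -/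
theorem IsGarsideFamily.headLaw_prod [IsLeftCancellative C] (hS : IsGarsideFamily S) {n : ℕ}
    {c : Mor C} (hc : IsProdSharp S n c) : ∀ (a b : Mor C) (h : a.dom = b.cod), c ≼ a.comp b h →
    ∃ d, IsProdSharp S n d ∧ ∃ h' : a.dom = d.cod, d ≼ b ∧ c ≼ a.comp d h' := by
  induction hc with
  | zero c hc =>
    intro a b h hcb
    exact ⟨Mor.id b.cod, IsProdSharp.zero _ (Mor.id_invertible _), h, LeftDvd.id_cod b,
      hc.dvd hcb.cod_eq⟩
  | succ n r c hrc hr hc ih =>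
    intro a b h hcb
    obtain ⟨g, hg, hag, ⟨b', hb', rfl⟩, ⟨x, hx, hrx⟩⟩ :=
      hS.hasHeadLaw a r hr b h ((LeftDvd.comp r c hrc).trans hcb)
    have hxb : x.dom = b'.cod := (congrArg Mor.dom hrx).symm.trans hb'
    have h1 : a.comp (g.comp b' hb') h = r.comp (x.comp b' hxb) hx := by
      rw [← Mor.comp_assoc a g b' hag hb', ← Mor.comp_assoc r x b' hx hxb]
      simp only [hrx]
    rw [h1] at hcb
    obtain ⟨d, hd, hxd, hdb, hcd⟩ := ih x b' hxb (LeftDvd.of_comp_left hcb)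
    have hgd : g.dom = d.cod := hb'.trans hdb.cod_eq.symm
    refine ⟨g.comp d hgd, IsProdSharp.succ n g d hgd hg hd, hag,
      LeftDvd.comp_left hgd hb' hdb, ?_⟩
    have h2 : a.comp (g.comp d hgd) hag = r.comp (x.comp d hxd) hx := by
      rw [← Mor.comp_assoc a g d hag hgd, ← Mor.comp_assoc r x d hx hxd]
      simp only [hrx]
    rw [h2]
    exact LeftDvd.comp_left (c := x.comp d hxd) hrc hx hcd

end HeadLaw

/-! ### Heads of characters -/

section Heads

variable {C : Type u} [Category.{v} C] [IsLeftCancellative C] {S : Set (Mor C)}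

/-- The standing assumptions: `S` is a `=^*`-transverse, locally bounded Garside family without
invertible elements in a finitely aligned left cancellative category. -/
structure IsBoundedGarside (S : Set (Mor C)) : Prop where
  aligned : IsFinitelyAligned C
  garside : IsGarsideFamily S
  notInvertible : ∀ s ∈ S, ¬ s.Invertible
  transverse : IsTransverse S
  bounded : IsLocallyBounded S

/-- `s` is the greatest element of `S` supported by the character `χ`. -/
def IsCharHead (S : Set (Mor C)) (χ : Omega C) (s : Mor C) : Prop :=
  s ∈ S ∧ Supports χ s ∧ ∀ r ∈ S, Supports χ r → r ≼ s

theorem isCharHead_chi {a s : Mor C} : IsCharHead S (chi a) s ↔ IsHead S a s := by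
  simp only [IsCharHead, IsHead, supports_chi]

theorem IsCharHead.dvd_of_mem_sharp (hS : IsBoundedGarside S) {χ : Omega C} {s r : Mor C}
    (h : IsCharHead S χ s) (hr : r ∈ sharp S) (hχ : Supports χ r) : r ≼ s := by
  rcases hr with ⟨t, ht, hrt⟩ | hr
  · exact hrt.dvd.trans (h.2.2 t ht (hχ.of_dvd hrt.dvd'))
  · exact hr.dvd (hχ.cod_eq hS.aligned h.2.1)

theorem IsCharHead.unique (hS : IsBoundedGarside S) {χ : Omega C} {s t : Mor C}
    (hs : IsCharHead S χ s) (ht : IsCharHead S χ t) : s = t :=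
  hS.transverse s hs.1 t ht.1 ((ht.2.2 s hs.1 hs.2.1).antisymm (hs.2.2 t ht.1 ht.2.1))

/-- A character that supports a non-invertible element has a head: otherwise directedness and the
existence of common right multiples in `S` give an infinite strictly increasing sequence in `S`. -/
theorem IsBoundedGarside.exists_isCharHead (hS : IsBoundedGarside S) {χ : Omega C} {a : Mor C}
    (ha : ¬ a.Invertible) (hχ : Supports χ a) : ∃ s, IsCharHead S χ s := by
  obtain ⟨s₀, hs₀, hsa⟩ := hS.garside.exists_dvd hS.notInvertible ha
  by_contra! hno
  have step : ∀ s : {s : Mor C // s ∈ S ∧ Supports χ s},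
      ∃ t : {s : Mor C // s ∈ S ∧ Supports χ s}, StrictLeftDvd s.1 t.1 := by
    rintro ⟨s, hs, hsχ⟩
    have h := hno s
    unfold IsCharHead at h
    push Not at h
    obtain ⟨r, hr, hrχ, hrs⟩ := h hs hsχ
    obtain ⟨b, hsb, hrb, hb⟩ := hsχ.directed hS.aligned hrχ
    obtain ⟨t, ht, hst, hrt, htb⟩ := hS.garside.right_comultiples s hs r hr b hsb hrb
    refine ⟨⟨t, ht, hb.of_dvd htb⟩, fun x hx => hst.trans hx, fun hts => hrs ?_⟩
    exact hrt.trans (hts (LeftDvd.refl s))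
  choose f hf using step
  let g : ℕ → {s : Mor C // s ∈ S ∧ Supports χ s} := fun n =>
    f^[n] ⟨s₀, hs₀, hχ.of_dvd hsa⟩
  refine hS.bounded s₀.cod ⟨fun n => (g n).1, fun n => ⟨(g n).2.1, ?_⟩, fun n => ?_⟩
  · exact (g n).2.2.cod_eq hS.aligned (hχ.of_dvd hsa)
  · simp only [g, Function.iterate_succ_apply']
    exact hf _

theorem IsBoundedGarside.exists_isHead (hS : IsBoundedGarside S) {a : Mor C}
    (ha : ¬ a.Invertible) : ∃ s, IsHead S a s := by
  obtain ⟨s, hs⟩ := hS.exists_isCharHead ha (supports_chi.2 (LeftDvd.refl a))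
  exact ⟨s, isCharHead_chi.1 hs⟩

theorem IsBoundedGarside.head_or_object (hS : IsBoundedGarside S) (χ : Omega C) :
    (∃ s, IsCharHead S χ s) ∨ ∃ x : C, χ = chi (Mor.id x) := by
  by_cases h : ∃ a : Mor C, ¬ a.Invertible ∧ Supports χ a
  · obtain ⟨a, ha, hχ⟩ := h
    exact Or.inl (hS.exists_isCharHead ha hχ)
  · push Not at h
    obtain ⟨c, hc⟩ := exists_supports hS.aligned χ
    refine Or.inr ⟨c.cod, omega_ext hS.aligned fun a => ?_⟩
    rw [supports_chi]
    constructor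
    · intro ha
      have hi : a.Invertible := by
        by_contra hn
        exact h a hn ha
      exact hi.dvd (ha.cod_eq hS.aligned (hc.of_dvd (LeftDvd.id_cod c)))
    · exact fun ha => hc.of_dvd (ha.trans (LeftDvd.id_cod c))

theorem not_isCharHead_object (hS : IsBoundedGarside S) {x : C} {s : Mor C} :
    ¬ IsCharHead S (chi (Mor.id x)) s := fun h =>
  hS.notInvertible s h.1 ((Mor.id_invertible x).of_dvd (supports_chi.1 h.2.1))

/-- The head law for characters. -/
theorem IsTranslate.dvd_of_isCharHead (hS : IsBoundedGarside S) {a x s : Mor C} {χ ψ : Omega C}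
    (h : IsTranslate a χ ψ) (hx : IsCharHead S χ x) (hax : a.dom = x.cod) (hs : s ∈ sharp S)
    (hsψ : Supports ψ s) : s ≼ a.comp x hax := by
  obtain ⟨y, hy, hχy, hsy⟩ := h.exists_of_supports hS.aligned hsψ
  obtain ⟨g, hg, hag, hgy, hsg⟩ := hS.garside.hasHeadLaw a s hs y hy hsy
  exact hsg.trans (LeftDvd.comp_left hag hax (hx.dvd_of_mem_sharp hS hg (hχy.of_dvd hgy)))

/-- The head of a translate `a.χ` is the head of `a x`, where `x` is the head of `χ`. -/
theorem IsTranslate.isCharHead (hS : IsBoundedGarside S) {a x s : Mor C} {χ ψ : Omega C}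
    (h : IsTranslate a χ ψ) (hx : IsCharHead S χ x) (hax : a.dom = x.cod) :
    IsHead S (a.comp x hax) s ↔ IsCharHead S ψ s := by
  have hψ : Supports ψ (a.comp x hax) := (h.2 x hax).2 hx.2.1
  constructor
  · intro hs
    exact ⟨hs.1, hψ.of_dvd hs.2.1, fun r hr hrψ =>
      hs.2.2 r hr (h.dvd_of_isCharHead hS hx hax (mem_sharp hr) hrψ)⟩
  · intro hs
    exact ⟨hs.1, h.dvd_of_isCharHead hS hx hax (mem_sharp hs.1) hs.2.1, fun r hr hrax =>
      hs.2.2 r hr (hψ.of_dvd hrax)⟩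

theorem IsTranslate.isCharHead_of_normalPair (hS : IsBoundedGarside S) {s t : Mor C}
    {χ ψ : Omega C} (h : IsTranslate s χ ψ) (hs : s ∈ S) (ht : IsCharHead S χ t)
    (hst : NormalPair S s t) : IsCharHead S ψ s := by
  obtain ⟨hd, hn⟩ := hst
  exact ⟨hs, h.1, fun r hr hrψ => hn r hr (h.dvd_of_isCharHead hS ht hd (mem_sharp hr) hrψ)⟩

theorem IsTranslate.normalPair {s t : Mor C} {χ ψ : Omega C} (hS : IsBoundedGarside S)
    (h : IsTranslate s χ ψ) (hs : IsCharHead S ψ s) (ht : Supports χ t) : NormalPair S s t :=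
  ⟨h.dom_eq hS.aligned ht, fun r hr hrst => hs.2.2 r hr (((h.2 t _).2 ht).of_dvd hrst)⟩

/-- `IsPrefix S n χ p χ'`: the element `p` is the product of the first `n` letters of the character
`χ`, obtained by splitting off heads, and `χ = p.χ'`. -/
inductive IsPrefix (S : Set (Mor C)) : ℕ → Omega C → Mor C → Omega C → Prop
  | zero (χ : Omega C) (x : C) : Supports χ (Mor.id x) → IsPrefix S 0 χ (Mor.id x) χ
  | succ (n : ℕ) (χ χ₁ χ' : Omega C) (s p : Mor C) (h : s.dom = p.cod) : IsCharHead S χ s →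
      IsTranslate s χ₁ χ → IsPrefix S n χ₁ p χ' → IsPrefix S (n + 1) χ (s.comp p h) χ'

theorem IsPrefix.isTranslate {n : ℕ} {χ χ' : Omega C} {p : Mor C} (h : IsPrefix S n χ p χ') :
    IsTranslate p χ' χ := by
  induction h with
  | zero χ x hx => exact isTranslate_id hx
  | succ n χ χ₁ χ' s p h hs ht _ ih => exact ih.comp h ht

theorem IsPrefix.snoc {n : ℕ} {χ χ' χ'' : Omega C} {p s : Mor C} (h : IsPrefix S n χ p χ')
    (hs : IsCharHead S χ' s) (ht : IsTranslate s χ'' χ') (hps : p.dom = s.cod) :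
    IsPrefix S (n + 1) χ (p.comp s hps) χ'' := by
  induction h with
  | zero χ x hx =>
    have := IsPrefix.succ 0 χ χ'' χ'' s (Mor.id s.dom) rfl hs ht
      (IsPrefix.zero χ'' _ ht.supports_id)
    rw [Mor.comp_id s s.dom rfl] at this
    rwa [Mor.id_comp]
  | succ n χ χ₁ χ' t p h ht' hχ _ ih =>
    rw [Mor.comp_assoc t p s h hps]
    exact IsPrefix.succ (n + 1) χ χ₁ χ'' t (p.comp s hps) h ht' hχ (ih hs ht hps)

/-- A supported product of `n` elements of `S` left divides the product of the first `n` letters. -/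
theorem IsPrefix.dvd (hS : IsBoundedGarside S) {n : ℕ} {χ χ' : Omega C} {p : Mor C}
    (h : IsPrefix S n χ p χ') : ∀ c, IsProdSharp S n c → Supports χ c → c ≼ p := by
  induction h with
  | zero χ x hx =>
    rintro c ⟨_, hc⟩ hχ
    exact hc.dvd (hχ.cod_eq hS.aligned hx)
  | succ n χ χ₁ χ' s p hsp hs ht _ ih =>
    intro c hc hχ
    cases hc with
    | succ _ r c hrc hr hc =>
      obtain ⟨x, hx, rfl⟩ := hs.dvd_of_mem_sharp hS hr (hχ.of_dvd (LeftDvd.comp r c hrc))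
      obtain ⟨y, hy, hχy, hcy⟩ := ht.exists_of_supports hS.aligned hχ
      rw [Mor.comp_assoc r x y hx hy] at hcy
      obtain ⟨d, hd, hxd, hdy, hcd⟩ :=
        hS.garside.headLaw_prod hc x y hy (LeftDvd.of_comp_left hcy)
      rw [Mor.comp_assoc r x p hx hsp]
      exact LeftDvd.comp_left (c := x.comp p hsp) hrc hx
        (hcd.trans (LeftDvd.comp_left hxd hsp (ih d hd (hχy.of_dvd hdy))))

end Heads

/-! ### Characters of normal words -/

section Words

variable {C : Type u} [Category.{v} C]

theorem Mor.comp_congr {a a' b b' : Mor C} {h : a.dom = b.cod} (ha : a = a') (hb : b = b')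
    (h' : a'.dom = b'.cod) : a.comp b h = a'.comp b' h' := by
  subst ha hb
  rfl

theorem prefixProd_cod (w : ℕ → Mor C) (h : ∀ n, (w n).dom = (w (n + 1)).cod) (n : ℕ) :
    (prefixProd w h n).1.cod = (w 0).cod := by
  induction n with
  | zero => rfl
  | succ n ih => exact ih

theorem prefixProd_succ_left (w : ℕ → Mor C) (h : ∀ n, (w n).dom = (w (n + 1)).cod) (n : ℕ) :
    (prefixProd w h (n + 1)).1 =
      (w 0).comp (prefixProd (fun k => w (k + 1)) (fun k => h (k + 1)) n).1
        ((h 0).trans (prefixProd_cod (fun k => w (k + 1)) (fun k => h (k + 1)) n).symm) := by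
  induction n with
  | zero => rfl
  | succ n ih =>
    have hd := (prefixProd (fun k => w (k + 1)) (fun k => h (k + 1)) n).2.trans (h (n + 1))
    exact (Mor.comp_congr (h := (prefixProd w h (n + 1)).2.trans (h (n + 1))) ih rfl hd).trans
      (Mor.comp_assoc _ _ _ _ _)

theorem prefixProd_dvd_succ (w : ℕ → Mor C) (h : ∀ n, (w n).dom = (w (n + 1)).cod) (n : ℕ) :
    (prefixProd w h n).1 ≼ (prefixProd w h (n + 1)).1 :=
  ⟨w (n + 1), (prefixProd w h n).2.trans (h n), rfl⟩

theorem prefixProd_dvd_of_le (w : ℕ → Mor C) (h : ∀ n, (w n).dom = (w (n + 1)).cod) {n m : ℕ}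
    (hnm : n ≤ m) : (prefixProd w h n).1 ≼ (prefixProd w h m).1 := by
  induction hnm with
  | refl => exact LeftDvd.refl _
  | step _ ih => exact ih.trans (prefixProd_dvd_succ w h _)

theorem IsPathProd.exists_cons {l : List (Mor C)} {a : Mor C} (h : IsPathProd l a) :
    ∃ t l', l = t :: l' ∧ t ≼ a := by
  cases h with
  | single => exact ⟨a, [], rfl, LeftDvd.refl a⟩
  | cons s l b h hl => exact ⟨s, l, rfl, LeftDvd.comp _ _ _⟩

variable [IsLeftCancellative C] {S : Set (Mor C)}

/-- The first letter of a finite normal word is the head of its product. -/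
theorem IsPathProd.isHead (hS : IsBoundedGarside S) {l : List (Mor C)} {a : Mor C}
    (h : IsPathProd l a) (hmem : ∀ s ∈ l, s ∈ S) (hn : l.IsChain (NormalPair S)) :
    ∃ t l', l = t :: l' ∧ IsHead S a t := by
  induction h with
  | single a =>
    exact ⟨a, [], rfl, hmem a (List.mem_singleton_self a), LeftDvd.refl a, fun _ _ h => h⟩
  | cons a l b hab hl ih =>
    obtain ⟨t, l', rfl, ht⟩ := ih (fun s hs => hmem s (List.mem_cons_of_mem a hs)) hn.tail
    refine ⟨a, t :: l', rfl, isCharHead_chi.1 ?_⟩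
    exact (isTranslate_chi a b hab).isCharHead_of_normalPair hS (hmem a List.mem_cons_self)
      (isCharHead_chi.2 ht) (List.isChain_cons_cons.1 hn).1

theorem dvd_first_of_dvd_prefixProd (hS : IsBoundedGarside S) (n : ℕ) :
    ∀ (w : ℕ → Mor C) (hn : ∀ n, NormalPair S (w n) (w (n + 1))), ∀ r ∈ sharp S,
      r ≼ (prefixProd w (fun k => (hn k).1) n).1 → r ≼ w 0 := by
  induction n with
  | zero => exact fun w hn r hr h => h
  | succ n ih =>
    intro w hn r hr h
    rw [prefixProd_succ_left] at h
    obtain ⟨g, hg, hwg, hgp, hrg⟩ := hS.garside.hasHeadLaw (w 0) r hr _ _ h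
    have h1 := ih (fun k => w (k + 1)) (fun k => hn (k + 1)) g hg hgp
    have h2 : r ≼ (w 0).comp (w 1) (hn 0).1 := hrg.trans (LeftDvd.comp_left hwg _ h1)
    rcases hr with ⟨t, ht, hrt⟩ | hr
    · exact hrt.dvd.trans ((hn 0).2 t ht (hrt.dvd'.trans h2))
    · exact hr.dvd h2.cod_eq

theorem supports_infinite {w : ℕ → Mor C} {hw : ∀ n, w n ∈ S}
    {hn : ∀ n, NormalPair S (w n) (w (n + 1))} {c : Mor C} :
    Supports (NormalWord.infinite w hw hn).chi c ↔
      ∃ n, c ≼ (prefixProd w (fun k => (hn k).1) n).1 :=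
  supports_chiSeq (ha := fun n => prefixProd_dvd_succ w (fun k => (hn k).1) n)

theorem isTranslate_infinite (w : ℕ → Mor C) (hw : ∀ n, w n ∈ S)
    (hn : ∀ n, NormalPair S (w n) (w (n + 1))) :
    IsTranslate (w 0)
      (NormalWord.infinite (fun k => w (k + 1)) (fun k => hw (k + 1)) fun k => hn (k + 1)).chi
      (NormalWord.infinite w hw hn).chi := by
  refine ⟨supports_infinite.2 ⟨0, LeftDvd.refl _⟩, fun x hx => ?_⟩
  rw [supports_infinite, supports_infinite]
  constructor
  · rintro ⟨n, h⟩
    have h1 := h.trans (prefixProd_dvd_succ w _ n)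
    rw [prefixProd_succ_left] at h1
    exact ⟨n, LeftDvd.of_comp_left h1⟩
  · rintro ⟨n, h⟩
    refine ⟨n + 1, ?_⟩
    rw [prefixProd_succ_left]
    exact LeftDvd.comp_left hx _ h

theorem isCharHead_infinite (hS : IsBoundedGarside S) (w : ℕ → Mor C) (hw : ∀ n, w n ∈ S)
    (hn : ∀ n, NormalPair S (w n) (w (n + 1))) :
    IsCharHead S (NormalWord.infinite w hw hn).chi (w 0) := by
  refine ⟨hw 0, (isTranslate_infinite w hw hn).1, fun r hr h => ?_⟩
  obtain ⟨n, h⟩ := supports_infinite.1 h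
  exact dvd_first_of_dvd_prefixProd hS n w hn r (mem_sharp hr) h

/-- The first letter of a normal word is the head of its character; splitting it off leaves the
character of the remaining word or of an object. -/
theorem NormalWord.exists_head (hS : IsBoundedGarside S) (w : NormalWord S) :
    ∃ s ∈ w.letters, ∃ χ, IsCharHead S w.chi s ∧ IsTranslate s χ w.chi ∧
      ((∃ w' : NormalWord S, χ = w'.chi ∧ w'.letters ⊆ w.letters ∧
          ∀ D, w.EndsIn D → w'.EndsIn D) ∨
        ∃ x, χ = GarsideCat.chi (Mor.id x) ∧ ∀ D, w.EndsIn D → x ∈ D) := by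
  cases w with
  | finite l a hl hmem hn =>
    obtain ⟨t, l', rfl, ht⟩ := hl.isHead hS hmem hn
    cases hl with
    | single =>
      exact ⟨a, List.mem_singleton_self a, _, isCharHead_chi.2 ht, isTranslate_chi_id a,
        Or.inr ⟨a.dom, rfl, fun D hD => hD⟩⟩
    | cons _ _ b hab hl =>
      exact ⟨t, List.mem_cons_self, _, isCharHead_chi.2 ht, isTranslate_chi t b hab,
        Or.inl ⟨.finite l' b hl (fun s hs => hmem s (List.mem_cons_of_mem t hs)) hn.tail, rfl,
          fun s hs => List.mem_cons_of_mem t hs, fun D hD => hD⟩⟩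
  | infinite w hw hn =>
    exact ⟨w 0, ⟨0, rfl⟩, _, isCharHead_infinite hS w hw hn, isTranslate_infinite w hw hn,
      Or.inl ⟨_, rfl, by rintro _ ⟨n, rfl⟩; exact ⟨n + 1, rfl⟩, fun D hD => trivial⟩⟩

/-- For some decomposition `χ = p.χ'`, the element `t` is the head of `χ'`. -/
def HasLetter (S : Set (Mor C)) (χ : Omega C) (t : Mor C) : Prop :=
  ∃ p χ', IsTranslate p χ' χ ∧ IsCharHead S χ' t

theorem IsCharHead.hasLetter {χ : Omega C} {t : Mor C} (h : IsCharHead S χ t) :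
    HasLetter S χ t :=
  ⟨_, χ, isTranslate_id (h.2.1.of_dvd (LeftDvd.id_cod t)), h⟩

theorem HasLetter.of_isTranslate (hC : IsFinitelyAligned C) {χ ψ : Omega C} {s t : Mor C}
    (hs : IsTranslate s χ ψ) (h : HasLetter S χ t) : HasLetter S ψ t := by
  obtain ⟨p, χ', hp, ht⟩ := h
  exact ⟨_, χ', hp.comp (hs.dom_eq hC hp.1) hs, ht⟩

theorem NormalWord.hasLetter (hS : IsBoundedGarside S) (w : NormalWord S) {t : Mor C}
    (ht : t ∈ w.letters) : HasLetter S w.chi t := by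
  cases w with
  | finite l a hl hmem hn =>
    change t ∈ l at ht
    change HasLetter S (GarsideCat.chi a) t
    induction hl with
    | single a =>
      obtain rfl := List.mem_singleton.1 ht
      exact IsCharHead.hasLetter (isCharHead_chi.2
        ⟨hmem t ht, LeftDvd.refl t, fun _ _ h => h⟩)
    | cons a l b hab hl ih =>
      rcases List.mem_cons.1 ht with rfl | ht
      · obtain ⟨t', l', h, ht'⟩ := (IsPathProd.cons t l b hab hl).isHead hS hmem hn
        obtain ⟨rfl, rfl⟩ := List.cons.inj h
        exact (isCharHead_chi.2 ht').hasLetter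
      · exact (ih (fun s hs => hmem s (List.mem_cons_of_mem a hs)) hn.tail ht).of_isTranslate
          hS.aligned (isTranslate_chi a b hab)
  | infinite w hw hn =>
    obtain ⟨n, rfl⟩ := ht
    induction n generalizing w with
    | zero => exact (isCharHead_infinite hS w hw hn).hasLetter
    | succ n ih =>
      exact (ih _ (fun k => hw (k + 1)) fun k => hn (k + 1)).of_isTranslate hS.aligned
        (isTranslate_infinite w hw hn)

/-! ### The coinductive description of `X(T, D)` -/

/-- Every character in `Y` is the character of an object in `D`, or has a head in `T` such that
splitting off the head leaves a character in `Y`. -/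
def IsProgressive (S T : Set (Mor C)) (D : Set C) (Y : Set (Omega C)) : Prop :=
  ∀ χ ∈ Y, (∃ x ∈ D, χ = chi (Mor.id x)) ∨
    ∃ s ∈ T, ∃ χ' ∈ Y, IsCharHead S χ s ∧ IsTranslate s χ' χ

/-- A non-empty word with letters in `T` loses its first letter, which is the head of its
character. -/
theorem isProgressive_subspaceOf (hS : IsBoundedGarside S) (T : Set (Mor C)) (D : Set C) :
    IsProgressive S T D (subspaceOf S T D) := by
  rintro χ (⟨w, hw, hD, rfl⟩ | h)
  · obtain ⟨s, hs, χ', h1, h2, ⟨w', rfl, h4, h5⟩ | ⟨x, rfl, hx⟩⟩ := w.exists_head hS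
    · exact Or.inr ⟨s, hw hs, _, Or.inl ⟨w', h4.trans hw, h5 D hD, rfl⟩, h1, h2⟩
    · exact Or.inr ⟨s, hw hs, _, Or.inr ⟨x, hx D hD, rfl⟩, h1, h2⟩
  · exact Or.inl h

/-- A finite normal word, or an object, can be prolonged to the left by a head. -/
theorem exists_finite_cons (hS : IsBoundedGarside S) {T : Set (Mor C)} {D : Set C}
    {χ ψ : Omega C} {s : Mor C} (hs : s ∈ T) (h : IsCharHead S ψ s) (ht : IsTranslate s χ ψ)
    (hχ : (∃ x ∈ D, χ = chi (Mor.id x)) ∨ ∃ l a, IsPathProd l a ∧ (∀ s ∈ l, s ∈ T) ∧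
      l.IsChain (NormalPair S) ∧ a.dom ∈ D ∧ χ = chi a) :
    ∃ l a, IsPathProd l a ∧ (∀ s ∈ l, s ∈ T) ∧
      l.IsChain (NormalPair S) ∧ a.dom ∈ D ∧ ψ = chi a := by
  rcases hχ with ⟨x, hx, rfl⟩ | ⟨l, a, hl, hmem, hn, ha, rfl⟩
  · obtain rfl : s.dom = x := (supports_chi.1 ht.supports_id).cod_eq
    exact ⟨[s], s, .single s, by simpa using hs, List.isChain_singleton s, hx,
      ht.right_unique hS.aligned (isTranslate_chi_id s)⟩
  · have hsa : s.dom = a.cod := ht.dom_eq hS.aligned (supports_chi.2 (LeftDvd.refl a))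
    refine ⟨s :: l, s.comp a hsa, .cons s l a hsa hl, ?_, ?_, ha,
      ht.right_unique hS.aligned (isTranslate_chi s a hsa)⟩
    · intro r hr
      rcases List.mem_cons.1 hr with rfl | hr
      · exact hs
      · exact hmem r hr
    · obtain ⟨t, l', rfl, hta⟩ := hl.exists_cons
      exact List.isChain_cons_cons.2 ⟨ht.normalPair hS h (supports_chi.2 hta), hn⟩

/-- `X(T, D)` contains every set with the property in `IsProgressive`: the successive heads of a
character spell a normal word. If the word is infinite, the character is determined by it since
every supported element, a product of `n` elements of `S`, left divides the product of the first
`n` letters. -/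
theorem IsProgressive.subset_subspaceOf (hS : IsBoundedGarside S) {T : Set (Mor C)} {D : Set C}
    {Y : Set (Omega C)} (hY : IsProgressive S T D Y) (hTS : T ⊆ S) : Y ⊆ subspaceOf S T D := by
  intro χ hχ
  have step : ∀ χ : Y, ∃ χ' : Y, (∃ x ∈ D, χ.1 = chi (Mor.id x)) ∨
      ∃ s ∈ T, IsCharHead S χ.1 s ∧ IsTranslate s χ'.1 χ.1 := by
    rintro ⟨χ, hχ⟩
    rcases hY χ hχ with h | ⟨s, hs, χ', hχ', h⟩
    · exact ⟨⟨χ, hχ⟩, Or.inl h⟩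
    · exact ⟨⟨χ', hχ'⟩, Or.inr ⟨s, hs, h⟩⟩
  choose f hf using step
  by_cases h : ∃ n, ∃ x ∈ D, (f^[n] ⟨χ, hχ⟩).1 = chi (Mor.id x)
  · obtain ⟨n, h⟩ := h
    have key : ∀ (n : ℕ) (χ : Y), (∃ x ∈ D, (f^[n] χ).1 = chi (Mor.id x)) →
        (∃ x ∈ D, χ.1 = chi (Mor.id x)) ∨ ∃ l a, IsPathProd l a ∧ (∀ s ∈ l, s ∈ T) ∧
          l.IsChain (NormalPair S) ∧ a.dom ∈ D ∧ χ.1 = chi a := by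
      intro n
      induction n with
      | zero => exact fun χ h => Or.inl h
      | succ n ih =>
        intro χ h
        rcases hf χ with h' | ⟨s, hs, h1, h2⟩
        · exact Or.inl h'
        · exact Or.inr (exists_finite_cons hS hs h1 h2 (ih (f χ) h))
    rcases key n ⟨χ, hχ⟩ h with h | ⟨l, a, hl, hmem, hn, ha, h⟩
    · exact Or.inr h
    · exact Or.inl ⟨.finite l a hl (fun s hs => hTS (hmem s hs)) hn, hmem, ha, h⟩
  · push Not at h
    let g : ℕ → Y := fun n => f^[n] ⟨χ, hχ⟩
    have hg : ∀ n, ∃ s ∈ T, IsCharHead S (g n).1 s ∧ IsTranslate s (g (n + 1)).1 (g n).1 := by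
      intro n
      rcases hf (g n) with ⟨x, hx, hgx⟩ | hs
      · exact absurd hgx (h n x hx)
      · have : g (n + 1) = f (g n) := Function.iterate_succ_apply' f n _
        rwa [this]
    choose w hwT hhead htrans using hg
    have hn : ∀ n, NormalPair S (w n) (w (n + 1)) := fun n =>
      (htrans n).normalPair hS (hhead n) (hhead (n + 1)).2.1
    have hpre : ∀ n, IsPrefix S (n + 1) χ (prefixProd w (fun k => (hn k).1) n).1
        (g (n + 1)).1 := by
      intro n
      induction n with
      | zero =>
        have := IsPrefix.succ 0 χ (g 1).1 (g 1).1 (w 0) (Mor.id (w 0).dom) rfl (hhead 0)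
          (htrans 0) (IsPrefix.zero _ _ (htrans 0).supports_id)
        rwa [Mor.comp_id (w 0) (w 0).dom rfl] at this
      | succ n ih =>
        exact ih.snoc (hhead (n + 1)) (htrans (n + 1))
          ((prefixProd w (fun k => (hn k).1) n).2.trans (hn n).1)
    refine Or.inl ⟨.infinite w (fun n => hTS (hwT n)) hn, ?_, trivial, ?_⟩
    · rintro _ ⟨n, rfl⟩
      exact hwT n
    · refine omega_ext hS.aligned fun c => Iff.trans ?_ supports_infinite.symm
      constructor
      · intro hc
        obtain ⟨n, hcn⟩ := hS.garside.exists_isProdSharp c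
        exact ⟨n, (hpre n).dvd hS c (hcn.mono n.le_succ) hc⟩
      · rintro ⟨n, hc⟩
        exact (hpre n).isTranslate.1.of_dvd hc

/-- Every character of `Ω` is the character of a normal word or of an object. -/
theorem subspaceOf_univ (hS : IsBoundedGarside S) (χ : Omega C) :
    χ ∈ subspaceOf S S Set.univ := by
  refine IsProgressive.subset_subspaceOf (Y := Set.univ) hS ?_ subset_rfl (Set.mem_univ χ)
  intro χ _
  rcases hS.head_or_object χ with ⟨s, hs⟩ | ⟨x, hx⟩
  · obtain ⟨χ', h⟩ := exists_untranslate hs.2.1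
    exact Or.inr ⟨s, hs.1, χ', trivial, hs, h⟩
  · exact Or.inl ⟨x, trivial, hx⟩

theorem IsCharHead.mem_lettersOf (hS : IsBoundedGarside S) {X : Set (Omega C)} {χ : Omega C}
    {t : Mor C} (h : IsCharHead S χ t) (hχ : χ ∈ X) : t ∈ lettersOf S X := by
  rcases subspaceOf_univ hS χ with ⟨w, -, -, rfl⟩ | ⟨x, -, rfl⟩
  · obtain ⟨s, hs, -, h1, -⟩ := w.exists_head hS
    exact ⟨w, hχ, h.unique hS h1 ▸ hs⟩
  · exact absurd h (not_isCharHead_object hS)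

/-- For an invariant subspace, the letters are the heads of the characters. -/
theorem mem_lettersOf_iff (hS : IsBoundedGarside S) {X : Set (Omega C)} (hX : IsInvariant X)
    {t : Mor C} : t ∈ lettersOf S X ↔ ∃ χ ∈ X, IsCharHead S χ t := by
  constructor
  · rintro ⟨w, hw, ht⟩
    obtain ⟨p, χ, hp, h⟩ := w.hasLetter hS ht
    exact ⟨χ, ((isInvariant_iff hS.aligned).1 hX p χ _ hp).2 hw, h⟩
  · rintro ⟨χ, hχ, h⟩
    exact h.mem_lettersOf hS hχ

/-- If `(T, D)` is admissible, every element of `T` is the first letter of a normal word in `T` that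
is infinite or ends in `D`. -/
theorem subset_lettersOf_subspaceOf {T : Set (Mor C)} {D : Set C}
    (hTS : T ⊆ S) (hT : IsAdmissible S T D) : T ⊆ lettersOf S (subspaceOf S T D) := by
  intro t ht
  have step : ∀ t : T, ∃ t' : T, t.1.dom ∈ D ∨ NormalPair S t.1 t'.1 := by
    rintro ⟨t, ht⟩
    rcases hT t ht with ⟨t', ht', h⟩ | h
    · exact ⟨⟨t', ht'⟩, Or.inr h⟩
    · exact ⟨⟨t, ht⟩, Or.inl h⟩
  choose f hf using step
  by_cases h : ∃ n, (f^[n] ⟨t, ht⟩).1.dom ∈ D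
  · obtain ⟨n, h⟩ := h
    have key : ∀ (n : ℕ) (t : T), (f^[n] t).1.dom ∈ D → ∃ l a, IsPathProd (t.1 :: l) a ∧
        (∀ s ∈ t.1 :: l, s ∈ T) ∧ (t.1 :: l).IsChain (NormalPair S) ∧ a.dom ∈ D := by
      intro n
      induction n with
      | zero =>
        exact fun t h => ⟨[], t.1, .single _, by simp, List.isChain_singleton _, h⟩
      | succ n ih =>
        intro t h
        rcases hf t with h' | h'
        · exact ⟨[], t.1, .single _, by simp, List.isChain_singleton _, h'⟩
        · obtain ⟨l, a, hl, hmem, hn, ha⟩ := ih (f t) h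
          obtain ⟨t', l', hl', hta⟩ := hl.exists_cons
          obtain ⟨h1, -⟩ := List.cons.inj hl'
          have hd : t.1.dom = a.cod := h'.1.trans ((congrArg Mor.cod h1).trans hta.cod_eq)
          refine ⟨_ :: l, t.1.comp a hd, .cons t.1 _ a hd hl, ?_,
            List.isChain_cons_cons.2 ⟨h', hn⟩, ha⟩
          intro s hs
          rcases List.mem_cons.1 hs with rfl | hs
          · exact t.2
          · exact hmem s hs
    obtain ⟨l, a, hl, hmem, hn, ha⟩ := key n ⟨t, ht⟩ h
    exact ⟨.finite (t :: l) a hl (fun s hs => hTS (hmem s hs)) hn,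
      Or.inl ⟨.finite (t :: l) a hl (fun s hs => hTS (hmem s hs)) hn, hmem, ha, rfl⟩,
      List.mem_cons_self⟩
  · push Not at h
    let w : ℕ → Mor C := fun n => (f^[n] ⟨t, ht⟩).1
    have hw : ∀ n, w n ∈ T := fun n => (f^[n] ⟨t, ht⟩).2
    have hn : ∀ n, NormalPair S (w n) (w (n + 1)) := by
      intro n
      have h1 := (hf (f^[n] ⟨t, ht⟩)).resolve_left (h n)
      rwa [← Function.iterate_succ_apply' f n] at h1
    exact ⟨.infinite w (fun n => hTS (hw n)) hn,
      Or.inl ⟨.infinite w (fun n => hTS (hw n)) hn, by rintro _ ⟨n, rfl⟩; exact hw n, trivial,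
        rfl⟩, ⟨0, rfl⟩⟩

end Words

/-! ### From pairs to closed invariant subspaces -/

section PairToSubspace

variable {C : Type u} [Category.{v} C] [IsLeftCancellative C] {S T : Set (Mor C)} {D : Set C}

/-- The translates of `X(T, D)` form a progressive set: the head of `a.χ` is the head of `a x` for
some `x ∈ T ∪ D`, so it lies in `T`, and splitting it off leaves a translate of an element of
`X(T, D)`. -/
theorem isProgressive_translates (hS : IsBoundedGarside S) (hp : IsInvariantPair S T D) :
    IsProgressive S T D {ψ | ∃ c, ∃ χ ∈ subspaceOf S T D, IsTranslate c χ ψ} := by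
  rintro ψ ⟨c, χ, hχ, hc⟩
  rcases isProgressive_subspaceOf hS T D χ hχ with ⟨x, hx, rfl⟩ | ⟨t, ht, χ₁, hχ₁, h1, h2⟩
  · obtain rfl : c.dom = x := (supports_chi.1 hc.supports_id).cod_eq
    obtain rfl := hc.right_unique hS.aligned (isTranslate_chi_id c)
    by_cases hi : c.Invertible
    · exact Or.inl ⟨c.cod, hp.isoInvariant c hi hx, chi_eq_of_invertible hS.aligned hi⟩
    · obtain ⟨s, hs, hsc⟩ := hp.hInvariant c hi (Mor.id c.dom) (Or.inr ⟨_, hx, rfl⟩) rfl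
      rw [Mor.comp_id c c.dom rfl] at hsc
      obtain ⟨d, hd, hcd⟩ := hsc.2.1
      refine Or.inr ⟨s, hs, chi d, ⟨d, _, hχ, ?_⟩, isCharHead_chi.2 hsc, ?_⟩
      · have : c.dom = (s.comp d hd).dom := congrArg Mor.dom hcd
        rw [this]
        exact isTranslate_chi_id d
      · have := isTranslate_chi s d hd
        rwa [← hcd] at this
  · have hct : c.dom = t.cod := hc.dom_eq hS.aligned h1.2.1
    have ha : IsTranslate (c.comp t hct) χ₁ ψ := h2.comp hct hc
    have hni : ¬ (c.comp t hct).Invertible := fun h =>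
      hS.notInvertible t h1.1 h.right_of_comp
    obtain ⟨s, hs, hsψ⟩ : ∃ s ∈ T, IsCharHead S ψ s := by
      rcases isProgressive_subspaceOf hS T D χ₁ hχ₁ with ⟨x, hx, rfl⟩ | ⟨t', ht', -, -, h3, -⟩
      · obtain rfl : t.dom = x := (supports_chi.1 h2.supports_id).cod_eq
        obtain ⟨s, hs, hsc⟩ := hp.hInvariant _ hni (Mor.id t.dom) (Or.inr ⟨_, hx, rfl⟩) rfl
        rw [Mor.comp_id (c.comp t hct) t.dom rfl] at hsc
        obtain rfl := ha.right_unique hS.aligned (isTranslate_chi_id (c.comp t hct))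
        exact ⟨s, hs, isCharHead_chi.2 hsc⟩
      · have hd := ha.dom_eq hS.aligned h3.2.1
        obtain ⟨s, hs, hsc⟩ := hp.hInvariant _ hni t' (Or.inl ht') hd
        exact ⟨s, hs, (ha.isCharHead hS h3 hd).1 hsc⟩
    obtain ⟨d, hd, hcd⟩ := hc.dvd_of_isCharHead hS h1 hct (mem_sharp hsψ.1) hsψ.2.1
    obtain ⟨ψ₁, hψ₁⟩ := exists_untranslate hsψ.2.1
    rw [hcd] at ha
    exact Or.inr ⟨s, hs, ψ₁, ⟨d, χ₁, hχ₁, ha.of_comp hψ₁⟩, hsψ, hψ₁⟩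

theorem IsTranslate.mem_subspaceOf (hS : IsBoundedGarside S) (hp : IsInvariantPair S T D)
    {c : Mor C} {χ ψ : Omega C} (h : IsTranslate c χ ψ) (hχ : χ ∈ subspaceOf S T D) :
    ψ ∈ subspaceOf S T D :=
  (isProgressive_translates hS hp).subset_subspaceOf hS hp.subset ⟨c, χ, hχ, h⟩

/-- If `c` is supported by the character of a word in `X(T, D)`, then removing a sufficiently long
initial segment `p = c x` of the word and prolonging the rest by `x` removes `c`. -/
theorem exists_translate_of_supports (hS : IsBoundedGarside S) {c : Mor C} {n : ℕ}
    (hc : IsProdSharp S n c) : ∀ χ ∈ subspaceOf S T D, Supports χ c →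
      ∃ p, c ≼ p ∧ ∃ χ' ∈ subspaceOf S T D, IsTranslate p χ' χ := by
  have key : ∀ n, ∀ χ ∈ subspaceOf S T D,
      ∃ χ' ∈ subspaceOf S T D, ∃ p, IsTranslate p χ' χ ∧
        ((∃ x, χ' = chi (Mor.id x)) ∨ IsPrefix S n χ p χ') := by
    intro n
    induction n with
    | zero =>
      intro χ hχ
      obtain ⟨a, ha⟩ := exists_supports hS.aligned χ
      have h := ha.of_dvd (LeftDvd.id_cod a)
      exact ⟨χ, hχ, _, isTranslate_id h, Or.inr (.zero χ _ h)⟩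
    | succ n ih =>
      intro χ hχ
      rcases isProgressive_subspaceOf hS T D χ hχ with ⟨x, hx, rfl⟩ | ⟨s, hs, χ₁, hχ₁, h1, h2⟩
      · exact ⟨_, hχ, _, isTranslate_id (supports_chi.2 (LeftDvd.refl _)), Or.inl ⟨x, rfl⟩⟩
      · obtain ⟨χ', hχ', p, hp, h⟩ := ih χ₁ hχ₁
        have hd := h2.dom_eq hS.aligned hp.1
        exact ⟨χ', hχ', s.comp p hd, hp.comp hd h2,
          h.imp_right fun h => .succ n χ χ₁ χ' s p hd h1 h2 h⟩
  intro χ hχ hcχ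
  obtain ⟨χ', hχ', p, hp, ⟨x, rfl⟩ | h⟩ := key n χ hχ
  · obtain ⟨y, hy, hxy, hcy⟩ := hp.exists_of_supports hS.aligned hcχ
    refine ⟨p, hcy.trans ?_, _, hχ', hp⟩
    have := LeftDvd.comp_left (c := Mor.id x) hy (hy.trans (supports_chi.1 hxy).cod_eq)
      (supports_chi.1 hxy)
    rwa [Mor.comp_id] at this
  · exact ⟨p, h.dvd hS c hc hcχ, χ', hχ', hp⟩

theorem isInvariant_subspaceOf (hS : IsBoundedGarside S) (hp : IsInvariantPair S T D) :
    IsInvariant (subspaceOf S T D) := by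
  refine (isInvariant_iff hS.aligned).2 fun c χ ψ h => ⟨h.mem_subspaceOf hS hp, fun hψ => ?_⟩
  obtain ⟨n, hn⟩ := hS.garside.exists_isProdSharp c
  obtain ⟨p, ⟨x, hx, rfl⟩, χ', hχ', hpχ⟩ := exists_translate_of_supports hS hn ψ hψ h.1
  exact (hpχ.of_comp h).mem_subspaceOf hS hp hχ'

theorem isClosed_subspaceOf [CountableCategory C] (hS : IsBoundedGarside S)
    (hp : IsInvariantPair S T D) : IsClosed (subspaceOf S T D) := by
  have := Ideals.countable (C := C) hS.aligned
  have hinv := (isInvariant_iff hS.aligned).1 (isInvariant_subspaceOf hS hp)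
  refine isClosed_of_closure_subset (IsProgressive.subset_subspaceOf hS ?_ hp.subset)
  intro χ hχ
  obtain ⟨χs, hmem, hlim⟩ := mem_closure_iff_seq_limit.1 hχ
  have hlim' := (tendsto_omega_iff hS.aligned).1 hlim
  rcases hS.head_or_object χ with ⟨s, hs⟩ | ⟨x, rfl⟩
  · obtain ⟨χ', hχ'⟩ := exists_untranslate hs.2.1
    have hsup : ∀ᶠ i in atTop, Supports (χs i) s := by
      filter_upwards [hlim' s] with i hi using hi.2 hs.2.1
    obtain ⟨N, hN⟩ := eventually_atTop.1 hsup
    refine Or.inr ⟨s, ?_, χ', ?_, hs, hχ'⟩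
    · -- The heads of the approximating characters converge to `s`.
      have hhead : ∀ i, ∃ t ∈ T, IsCharHead S (χs (i + N)) t := by
        intro i
        rcases isProgressive_subspaceOf hS T D _ (hmem (i + N)) with
          ⟨x, hx, h⟩ | ⟨t, ht, -, -, h, -⟩
        · have h1 := hN (i + N) (Nat.le_add_left N i)
          rw [h] at h1
          exact absurd ((Mor.id_invertible x).of_dvd (supports_chi.1 h1))
            (hS.notInvertible s hs.1)
        · exact ⟨t, ht, h⟩
      choose t htT ht using hhead
      have hl : IsLimit S t s := by
        refine ⟨Or.inl hs.1, Eventually.of_forall fun i =>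
          (ht i).2.2 s hs.1 (hN _ (Nat.le_add_left N i)), ?_⟩
        rintro r (hr | ⟨x, -, rfl⟩) hfr
        · refine hs.2.2 r hr ?_
          have h1 := (tendsto_add_atTop_nat N).eventually (hlim' r)
          obtain ⟨i, hri, hi⟩ := (hfr.and_eventually h1).exists
          exact hi.1 ((ht i).2.1.of_dvd hri)
        · obtain ⟨i, hi⟩ := hfr.exists
          refine LeftDvd.id_of_eq (hi.cod_eq.trans ?_)
          exact (ht i).2.1.cod_eq hS.aligned (hN _ (Nat.le_add_left N i))
      rcases hp.maxClosed t htT s hl with h | ⟨x, -, rfl⟩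
      · exact h
      · exact absurd (Mor.id_invertible x) (hS.notInvertible _ hs.1)
    · have huntr : ∀ i, ∃ ψ, IsTranslate s ψ (χs (i + N)) := fun i =>
        exists_untranslate (hN _ (Nat.le_add_left N i))
      choose ψ hψ using huntr
      refine mem_closure_of_tendsto (f := ψ) (b := atTop) ((tendsto_omega_iff hS.aligned).2 ?_)
        (Eventually.of_forall fun i => (hinv s _ _ (hψ i)).2 (hmem _))
      intro c
      by_cases hc : s.dom = c.cod
      · filter_upwards [(tendsto_add_atTop_nat N).eventually (hlim' (s.comp c hc))] with i hi
        rwa [(hψ i).2, hχ'.2] at hi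
      · exact Eventually.of_forall fun i => iff_of_false
          (fun h => hc ((hψ i).dom_eq hS.aligned h)) (fun h => hc (hχ'.dom_eq hS.aligned h))
  · -- Either some approximating character is that of the object `x`, or all of them have heads, and
    -- these heads converge to `x`.
    left
    have hsup : ∀ᶠ i in atTop, Supports (χs i) (Mor.id x) := by
      filter_upwards [hlim' (Mor.id x)] with i hi using hi.2 (supports_chi.2 (LeftDvd.refl _))
    obtain ⟨N, hN⟩ := eventually_atTop.1 hsup
    by_cases hob : ∃ i, ∃ y ∈ D, χs (i + N) = chi (Mor.id y)
    · obtain ⟨i, y, hy, h⟩ := hob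
      have h1 := hN (i + N) (Nat.le_add_left N i)
      rw [h] at h1
      obtain rfl : x = y := (supports_chi.1 h1).cod_eq
      exact ⟨x, hy, rfl⟩
    · push Not at hob
      have hhead : ∀ i, ∃ t ∈ T, IsCharHead S (χs (i + N)) t := by
        intro i
        rcases isProgressive_subspaceOf hS T D _ (hmem (i + N)) with
          ⟨y, hy, h⟩ | ⟨t, ht, -, -, h, -⟩
        · exact absurd h (hob i y hy)
        · exact ⟨t, ht, h⟩
      choose t htT ht using hhead
      have hcod : ∀ i, x = (t i).cod := fun i =>
        (hN _ (Nat.le_add_left N i)).cod_eq hS.aligned (ht i).2.1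
      have hl : IsLimit S t (Mor.id x) := by
        refine ⟨Or.inr ⟨x, trivial, rfl⟩,
          Eventually.of_forall fun i => LeftDvd.id_of_eq (hcod i), ?_⟩
        rintro r (hr | ⟨y, -, rfl⟩) hfr
        · have h1 := (tendsto_add_atTop_nat N).eventually (hlim' r)
          obtain ⟨i, hri, hi⟩ := (hfr.and_eventually h1).exists
          exact supports_chi.1 (hi.1 ((ht i).2.1.of_dvd hri))
        · obtain ⟨i, hi⟩ := hfr.exists
          exact LeftDvd.id_of_eq (hi.cod_eq.trans (hcod i).symm)
      rcases hp.maxClosed t htT _ hl with h | ⟨y, hy, h⟩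
      · exact absurd (Mor.id_invertible x) (hS.notInvertible _ (hp.subset h))
      · obtain rfl := Mor.id_injective h
        exact ⟨y, hy, rfl⟩

theorem objectsOf_subspaceOf (hS : IsBoundedGarside S) : objectsOf (subspaceOf S T D) = D := by
  ext x
  constructor
  · intro hx
    rcases isProgressive_subspaceOf hS T D _ hx with ⟨y, hy, h⟩ | ⟨s, -, -, -, h, -⟩
    · exact chi_id_injective h ▸ hy
    · exact absurd h (not_isCharHead_object hS)
  · exact fun hx => Or.inr ⟨x, hx, rfl⟩

theorem lettersOf_subspaceOf (hS : IsBoundedGarside S) (hp : IsInvariantPair S T D) :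
    lettersOf S (subspaceOf S T D) = T := by
  refine Set.Subset.antisymm ?_ (subset_lettersOf_subspaceOf hp.subset hp.admissible)
  intro t ht
  obtain ⟨χ, hχ, h⟩ := (mem_lettersOf_iff hS (isInvariant_subspaceOf hS hp)).1 ht
  rcases isProgressive_subspaceOf hS T D _ hχ with ⟨y, hy, rfl⟩ | ⟨s, hs, -, -, h', -⟩
  · exact absurd h (not_isCharHead_object hS)
  · exact h.unique hS h' ▸ hs

end PairToSubspace

/-! ### From closed invariant subspaces to pairs -/

section SubspaceToPair

variable {C : Type u} [Category.{v} C] [IsLeftCancellative C] {S : Set (Mor C)}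
  {X : Set (Omega C)}

theorem isProgressive_of_isInvariant (hS : IsBoundedGarside S) (hX : IsInvariant X) :
    IsProgressive S (lettersOf S X) (objectsOf X) X := by
  intro χ hχ
  rcases hS.head_or_object χ with ⟨s, hs⟩ | ⟨x, rfl⟩
  · obtain ⟨χ', h⟩ := exists_untranslate hs.2.1
    exact Or.inr ⟨s, hs.mem_lettersOf hS hχ, χ',
      ((isInvariant_iff hS.aligned).1 hX s χ' χ h).2 hχ, hs, h⟩
  · exact Or.inl ⟨x, hχ, rfl⟩

theorem lettersOf_subset (hS : IsBoundedGarside S) (hX : IsInvariant X) : lettersOf S X ⊆ S := by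
  intro t ht
  obtain ⟨χ, -, h⟩ := (mem_lettersOf_iff hS hX).1 ht
  exact h.1

theorem isAdmissible_of_isInvariant (hS : IsBoundedGarside S) (hX : IsInvariant X) :
    IsAdmissible S (lettersOf S X) (objectsOf X) := by
  intro t ht
  obtain ⟨χ, hχ, h⟩ := (mem_lettersOf_iff hS hX).1 ht
  obtain ⟨χ', h'⟩ := exists_untranslate h.2.1
  have hχ' := ((isInvariant_iff hS.aligned).1 hX t χ' χ h').2 hχ
  rcases hS.head_or_object χ' with ⟨s, hs⟩ | ⟨x, rfl⟩
  · exact Or.inl ⟨s, hs.mem_lettersOf hS hχ', h'.normalPair hS h hs.2.1⟩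
  · obtain rfl : t.dom = x := (supports_chi.1 h'.supports_id).cod_eq
    exact Or.inr hχ'

theorem isHInvariant_of_isInvariant (hS : IsBoundedGarside S) (hX : IsInvariant X) :
    IsHInvariant S (lettersOf S X) (objectsOf X) := by
  have hX' := (isInvariant_iff hS.aligned).1 hX
  rintro a ha x (hx | ⟨y, hy, rfl⟩) h
  · obtain ⟨χ, hχ, hx⟩ := (mem_lettersOf_iff hS hX).1 hx
    obtain ⟨ψ, hψ⟩ := exists_translate (c := a) (hx.2.1.of_dvd (LeftDvd.id_of_eq h))
    obtain ⟨s, hs⟩ := hS.exists_isCharHead ha hψ.1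
    exact ⟨s, hs.mem_lettersOf hS ((hX' a χ ψ hψ).1 hχ), (hψ.isCharHead hS hx h).2 hs⟩
  · obtain rfl : a.dom = y := h
    rw [Mor.comp_id a a.dom rfl]
    obtain ⟨s, hs⟩ := hS.exists_isHead ha
    exact ⟨s, (isCharHead_chi.2 hs).mem_lettersOf hS ((hX' a _ _ (isTranslate_chi_id a)).1 hy), hs⟩

theorem isIsoInvariant_of_isInvariant (hC : IsFinitelyAligned C) (hX : IsInvariant X) :
    IsIsoInvariant (objectsOf X) := by
  intro w hw hd
  have h := ((isInvariant_iff hC).1 hX w _ _ (isTranslate_chi_id w)).1 hd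
  rwa [chi_eq_of_invertible hC hw] at h

/-- Characters supporting a common element converge along every ultrafilter. The limit takes the
value one at `e` if and only if almost all the characters do; the common element ensures that the
limit is not zero. -/
theorem exists_tendsto_ultrafilter (hC : IsFinitelyAligned C) (U : Ultrafilter ℕ)
    (χ : ℕ → Omega C) {c : Mor C} (hc : ∀ᶠ i in U, Supports (χ i) c) :
    ∃ ψ, Tendsto χ U (nhds ψ) := by
  classical
  refine ⟨⟨fun e => decide (∀ᶠ i in U, (χ i).1 e = true), ?_, ?_, ?_, ?_⟩, ?_⟩
  · exact ⟨principalIdeal c, decide_eq_true hc⟩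
  · intro e f
    rw [Bool.eq_iff_iff, Bool.and_eq_true, decide_eq_true_iff, decide_eq_true_iff,
      decide_eq_true_iff, ← eventually_and]
    simp only [(χ _).2.mul, Bool.and_eq_true]
  · intro e he
    simp only [(χ _).2.zero e he]
    simp [U.neBot.ne]
  · intro e F hF he h
    simp only [decide_eq_true_eq] at h ⊢
    by_contra! hno
    have h1 : ∀ f ∈ F, ∀ᶠ i in U, ¬ (χ i).1 f = true := fun f hf =>
      hno f hf
    obtain ⟨i, hi, hi'⟩ := (h.and ((Set.Finite.eventually_all hF).2 h1)).exists
    obtain ⟨f, hf, hif⟩ := (χ i).2.union e F hF he hi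
    exact hi' f hf hif
  · refine (tendsto_omega_iff hC).2 fun d => ?_
    by_cases hd : ∀ᶠ i in U, Supports (χ i) d
    · filter_upwards [hd] with i hi
      exact iff_of_true hi (decide_eq_true hd)
    · filter_upwards [Ultrafilter.eventually_not.2 hd] with i hi
      exact iff_of_false hi fun h => hd (of_decide_eq_true h)

/-- Letters converging to `s` are heads of characters in `X`; any limit point of these characters
has head `s`, or is the character of the object `s`. -/
theorem isMaxClosed_of_isClosed (hS : IsBoundedGarside S) (hX : IsInvariant X)
    (hcl : IsClosed X) : IsMaxClosed S (lettersOf S X) (objectsOf X) := by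
  rintro t ht s ⟨hs, hst, hmax⟩
  choose χ hχ hhead using fun i => (mem_lettersOf_iff hS hX).1 (ht i)
  let U : Ultrafilter ℕ := hyperfilter ℕ
  have hU : (U : Filter ℕ) ≤ atTop := Nat.hyperfilter_le_atTop
  have hsup : ∀ᶠ i in U, Supports (χ i) s := by
    filter_upwards [hU hst] with i hi using (hhead i).2.1.of_dvd hi
  obtain ⟨ψ, hψ⟩ := exists_tendsto_ultrafilter hS.aligned U χ hsup
  have hψX : ψ ∈ X := hcl.mem_of_tendsto hψ (Eventually.of_forall hχ)
  have hlim := (tendsto_omega_iff hS.aligned).1 hψ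
  have hψs : Supports ψ s := by
    obtain ⟨i, h1, h2⟩ := (hsup.and (hlim s)).exists
    exact h2.1 h1
  have hdvd : ∀ r ∈ S, Supports ψ r → r ≼ s := by
    intro r hr hrψ
    refine hmax r (Or.inl hr) (Frequently.filter_mono (Eventually.frequently ?_) hU)
    filter_upwards [hlim r] with i hi using (hhead i).2.2 r hr (hi.2 hrψ)
  rcases hs with hs | ⟨x, -, rfl⟩
  · exact Or.inl (IsCharHead.mem_lettersOf hS ⟨hs, hψs, hdvd⟩ hψX)
  · refine Or.inr ⟨x, ?_, rfl⟩
    rcases hS.head_or_object ψ with ⟨s, hs⟩ | ⟨y, rfl⟩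
    · exact absurd ((Mor.id_invertible x).of_dvd (hdvd s hs.1 hs.2.1)) (hS.notInvertible s hs.1)
    · obtain rfl : x = y := (supports_chi.1 hψs).cod_eq
      exact hψX

theorem isInvariantPair_of_closedInvariant (hS : IsBoundedGarside S) (hX : IsInvariant X)
    (hcl : IsClosed X) : IsInvariantPair S (lettersOf S X) (objectsOf X) where
  subset := lettersOf_subset hS hX
  admissible := isAdmissible_of_isInvariant hS hX
  hInvariant := isHInvariant_of_isInvariant hS hX
  isoInvariant := isIsoInvariant_of_isInvariant hS.aligned hX
  maxClosed := isMaxClosed_of_isClosed hS hX hcl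

/-- Prolonging a normal word `w 0, …, w n` by a character with head `w (n + 1)` gives a character
with first letters `w 0, …, w n`. -/
theorem exists_isPrefix_prefixProd (hS : IsBoundedGarside S) (n : ℕ) :
    ∀ (w : ℕ → Mor C) (_ : ∀ n, w n ∈ S) (hn : ∀ n, NormalPair S (w n) (w (n + 1)))
      (χ : Omega C), IsCharHead S χ (w (n + 1)) →
      ∃ ψ, IsPrefix S (n + 1) ψ (prefixProd w (fun k => (hn k).1) n).1 χ ∧
        IsCharHead S ψ (w 0) := by
  induction n with
  | zero =>
    intro w hw hn χ hχ
    obtain ⟨ψ, hψ⟩ := exists_translate (c := w 0)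
      (hχ.2.1.of_dvd (LeftDvd.id_of_eq (hn 0).1))
    have hh := hψ.isCharHead_of_normalPair hS (hw 0) hχ (hn 0)
    refine ⟨ψ, ?_, hh⟩
    have := IsPrefix.succ 0 ψ χ χ (w 0) (Mor.id (w 0).dom) rfl hh hψ
      (IsPrefix.zero _ _ hψ.supports_id)
    rwa [Mor.comp_id (w 0) (w 0).dom rfl] at this
  | succ n ih =>
    intro w hw hn χ hχ
    obtain ⟨ψ, hψ, hh⟩ := ih (fun k => w (k + 1)) (fun k => hw (k + 1)) (fun k => hn (k + 1)) χ hχ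
    obtain ⟨φ, hφ⟩ := exists_translate (c := w 0)
      (hh.2.1.of_dvd (LeftDvd.id_of_eq (hn 0).1))
    have hh' := hφ.isCharHead_of_normalPair hS (hw 0) hh (hn 0)
    refine ⟨φ, ?_, hh'⟩
    rw [prefixProd_succ_left]
    exact IsPrefix.succ (n + 1) φ ψ χ (w 0) _ _ hh' hφ hψ

/-- The character of an infinite normal word whose letters are letters of `X` is a limit of
elements of `X`: its `n`-th approximation is the product of the first `n + 1` letters applied to a
character in `X` whose head is the next letter. -/
theorem chi_infinite_mem (hS : IsBoundedGarside S) (hX : IsInvariant X) (hcl : IsClosed X)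
    (w : ℕ → Mor C) (hw : ∀ n, w n ∈ S) (hn : ∀ n, NormalPair S (w n) (w (n + 1)))
    (hwX : ∀ n, w n ∈ lettersOf S X) : (NormalWord.infinite w hw hn).chi ∈ X := by
  choose χ hχ hhead using fun n => (mem_lettersOf_iff hS hX).1 (hwX (n + 1))
  choose ψ hψ hψ' using fun n => exists_isPrefix_prefixProd hS n w hw hn (χ n) (hhead n)
  have hψX : ∀ n, ψ n ∈ X := fun n =>
    ((isInvariant_iff hS.aligned).1 hX _ _ _ (hψ n).isTranslate).1 (hχ n)
  refine hcl.mem_of_tendsto (f := ψ) (b := atTop) ((tendsto_omega_iff hS.aligned).2 fun c => ?_)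
    (Eventually.of_forall hψX)
  by_cases hc : Supports (NormalWord.infinite w hw hn).chi c
  · obtain ⟨n, hcn⟩ := supports_infinite.1 hc
    filter_upwards [eventually_ge_atTop n] with m hm
    exact iff_of_true
      ((hψ m).isTranslate.1.of_dvd (hcn.trans (prefixProd_dvd_of_le w _ hm))) hc
  · obtain ⟨n, hcn⟩ := hS.garside.exists_isProdSharp c
    filter_upwards [eventually_ge_atTop n] with m hm
    refine iff_of_false (fun h => hc (supports_infinite.2 ⟨m, ?_⟩)) hc
    exact (hψ m).dvd hS c (hcn.mono (hm.trans m.le_succ)) h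

theorem subspaceOf_lettersOf (hS : IsBoundedGarside S) (hX : IsInvariant X) (hcl : IsClosed X) :
    subspaceOf S (lettersOf S X) (objectsOf X) = X := by
  refine Set.Subset.antisymm ?_ ((isProgressive_of_isInvariant hS hX).subset_subspaceOf hS
    (lettersOf_subset hS hX))
  rintro χ (⟨w, hw, hD, rfl⟩ | ⟨x, hx, rfl⟩)
  · cases w with
    | finite l a hl hmem hn =>
      exact ((isInvariant_iff hS.aligned).1 hX a _ _ (isTranslate_chi_id a)).1 hD
    | infinite w hwS hn => exact chi_infinite_mem hS hX hcl w hwS hn fun n => hw ⟨n, rfl⟩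
  · exact hx

end SubspaceToPair

theorem lettersOf_mono {C : Type u} [Category.{v} C] [IsLeftCancellative C] {S : Set (Mor C)}
    {X Y : Set (Omega C)} (h : X ⊆ Y) : lettersOf S X ⊆ lettersOf S Y :=
  fun _ ⟨w, hw, ht⟩ => ⟨w, h hw, ht⟩

theorem subspaceOf_mono {C : Type u} [Category.{v} C] [IsLeftCancellative C] {S T T' : Set (Mor C)}
    {D D' : Set C} (hT : T ⊆ T') (hD : D ⊆ D') : subspaceOf S T D ⊆ subspaceOf S T' D' := by
  rintro χ (⟨w, hw, hwD, rfl⟩ | ⟨x, hx, rfl⟩)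
  · refine Or.inl ⟨w, hw.trans hT, ?_, rfl⟩
    cases w with
    | finite => exact hD hwD
    | infinite => trivial
  · exact Or.inr ⟨x, hD hx, rfl⟩

end GarsideCat

theorem mainTheorem2 {C : Type u} [Category.{v} C] [CountableCategory C]
    [GarsideCat.IsLeftCancellative C] (hC : GarsideCat.IsFinitelyAligned C)
    (S : Set (GarsideCat.Mor C)) (hS : GarsideCat.IsGarsideFamily S)
    (hinv : ∀ s ∈ S, ¬ s.Invertible) (htrans : GarsideCat.IsTransverse S)
    (hbdd : GarsideCat.IsLocallyBounded S) :
    ∃ Φ : GarsideCat.ClosedInvariant C ≃o GarsideCat.InvariantPair S,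
      (∀ X, (Φ X).1 = (GarsideCat.lettersOf S X.1, GarsideCat.objectsOf X.1)) ∧
      ∀ p, (Φ.symm p).1 = GarsideCat.subspaceOf S p.1.1 p.1.2 := by
  have h : GarsideCat.IsBoundedGarside S := ⟨hC, hS, hinv, htrans, hbdd⟩
  let Φ : GarsideCat.ClosedInvariant C ≃ GarsideCat.InvariantPair S :=
    { toFun := fun X => ⟨(GarsideCat.lettersOf S X.1, GarsideCat.objectsOf X.1),
        GarsideCat.isInvariantPair_of_closedInvariant h X.2.2 X.2.1⟩
      invFun := fun p => ⟨GarsideCat.subspaceOf S p.1.1 p.1.2,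
        GarsideCat.isClosed_subspaceOf h p.2, GarsideCat.isInvariant_subspaceOf h p.2⟩
      left_inv := fun X => Subtype.ext (GarsideCat.subspaceOf_lettersOf h X.2.2 X.2.1)
      right_inv := fun p => Subtype.ext (Prod.ext (GarsideCat.lettersOf_subspaceOf h p.2)
        (GarsideCat.objectsOf_subspaceOf h)) }
  refine ⟨⟨Φ, fun {X Y} => ⟨fun hXY => ?_, fun hXY => ?_⟩⟩, fun X => rfl, fun p => rfl⟩
  · have h1 := GarsideCat.subspaceOf_mono (S := S) hXY.1 hXY.2
    rw [← Φ.left_inv X, ← Φ.left_inv Y]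
    exact h1
  · exact ⟨GarsideCat.lettersOf_mono hXY, fun x hx => hXY hx⟩
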